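/- **Model.** Let $S\subset\mathbb R$ be compact, $\mathcal F$ a family of distribution functions on $S$, and $Q_y(u)=\inf\{s\in S: y(s)\ge u\}$ the quantile function of $y\in\mathcal F$. Let $X$ be a random vector in $[0,1]^p$ with mean $\mu$ and covariance matrix $\Sigma$, and $Y$ a random element of $\mathcal F$. For every $x\in[0,1]^p$ let $F(\cdot|x)\in\mathcal F$ have a quantile function $Q(\cdot|x)$ with $$Q(u|x)=\alpha(u)+\beta^*(u)^\top(x-\mu),\qquad Q(u|X)=E\{Q_Y(u)\mid X\}\quad\text{a.s.}\qquad(u\in[0,1]),$$ and, if $\Sigma$ is invertible (so that the weight below is defined), let $F(\cdot|x)$ minimize $y\mapsto E[\{1+(X-\mu)^\top\Sigma^{-1}(x-\mu)\}\int_0^1(Q_Y-Q_y)^2\,du]$ over $\mathcal F$. Put $\varepsilon(u)=Q_Y(u)-Q(u|X)$ and $T(s)=Q_Y(F(s|X))$. Assume: * $s\mapsto F(s|\mu)$ is continuous and strictly increasing on $S$; * $E\,e^{t\{\varepsilon(u)-\varepsilon(u')\}}\le e^{t^2|u-u'|^2/2}$ for all $t\in\mathbb R$ and $u,u'\in[0,1]$;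 * $C_T(s,s')=\mathrm{Cov}(T(s),T(s'))$ is continuous on $S\times S$ and $\mathrm{Cov}(T(s),T(s')\mid X)=C_T(s,s')$ a.s. for all $s,s'\in S$; * $\beta^*:[0,1]\to\mathbb R^p$ has bounded variation with respect to the Euclidean norm. The law of $(X,Y)$, and hence $p$ and $\beta^*$, is fixed, and so is an integer $r\ge 0$. **Estimator.** Let $(X_1,Y_1),(X_2,Y_2),\dots$ be independent copies of $(X,Y)$. For each sample size $n$ let $\lambda=\lambda_n>0$ and $M=M_n$ be arbitrary with $r<\min\{p,M\}$; put $u_m=m/M$, and let $\mathbf B^*\in\mathbb R^{p\times M}$ have columns $\beta^*(u_1),\dots,\beta^*(u_M)$. Assume that $\mathbf B^*\in\mathcal M_r=\{\mathbf B\in\mathbb R^{p\times M}:\operatorname{rank}\mathbf B=r\}$. Let $\mathcal J$ be a penalty function on $p\times M$ matrices (given for every $M$): nonnegative, with $\mathcal J(0)=0$, and continuous at $0$. Bars denote averages over $i\le n$; let $\widetilde{\mathbf X}$ be the $n\times p$ matrix with entries $X_{i,j}-\bar X_j$. Write $d(\mathbf B)=M^{-1/2}\|\mathbf B-\mathbf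 B^*\|_F$. Assume: * for all $\epsilon,\rho>0$ there is $C>0$, not depending on $n$, such that $|\mathcal J(\mathbf B)-\mathcal J(\mathbf B^*)|\le C\,d(\mathbf B)$ for all $\mathbf B\in\mathcal M_r$ with $\epsilon<d(\mathbf B)\le\rho$; * for every $\epsilon>0$ there is $c>0$, not depending on $n$, such that, with probability tending to one, $n^{-1}\|\widetilde{\mathbf X}(\mathbf B-\mathbf B^*)\|_F^2\ge c^2\|\mathbf B-\mathbf B^*\|_F^2$ for all $\mathbf B\in\mathcal M_r$ with $d(\mathbf B)\ge\epsilon$. Let $\widehat{\mathbf B}$, with probability tending to one, minimize over $\mathbf B=(b_{j,m})\in\mathcal M_r$ the criterion $$\sum_{i=1}^n\frac1M\sum_{m=1}^M\Big(Q_{Y_i}(u_m)-\overline Q_Y(u_m)-\sum_{j=1}^p b_{j,m}(X_{i,j}-\bar X_j)\Big)^2+\lambda\mathcal J(\mathbf B),$$ and let $\hat\beta^*:[0,1]\to\mathbb R^p$ be the piecewise linear interpolation of the columns $\hat\beta(u_1),\dots,\hat\beta(u_M)$ of $\widehat{\mathbf B}$, constant on $[0,u_1]$. **Theorem.** As $n\to\infty$,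 $$\Big(\int_0^1\|\hat\beta^*(u)-\beta^*(u)\|_2^2\,du\Big)^{1/2}=O_P\Big(\sqrt{r(p+M)/n}+\sqrt{\lambda pM/n}\Big)+O(M^{-1/2}),$$ that is, the left side is at most $R_n+s_n$ with $R_n$ of the stated stochastic order and a deterministic $s_n=O(M^{-1/2})$. -/

import Mathlib

open MeasureTheory ProbabilityTheory Filter Topology Asymptotics

noncomputable section

namespace FrechetQuantile

/-! ### Distributions, quantile functions, Wasserstein distance

A distribution function on the line is represented by the probability measure `y` it belongs to;
`cdf y` is the distribution function itself. -/

/-- The quantile function `Q_y(u) = inf {s ∈ S : y(s) ≥ u}` of a distribution `y` living on `S`. -/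
def quantile (S : Set ℝ) (y : Measure ℝ) (u : ℝ) : ℝ :=
  sInf {s : ℝ | s ∈ S ∧ u ≤ cdf y s}

/-- Squared `2`-Wasserstein distance between distributions living on `S`. -/
def wassersteinSq (S : Set ℝ) (y₁ y₂ : Measure ℝ) : ℝ :=
  ∫ u in (0 : ℝ)..1, (quantile S y₁ u - quantile S y₂ u) ^ 2

/-! ### The global Fréchet regression model -/

/-- The cube `[0, 1]^p`. -/
def unitCube (p : ℕ) : Set (EuclideanSpace ℝ (Fin p)) :=
  {x | ∀ j, x j ∈ Set.Icc (0 : ℝ) 1}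

section Population

variable {Ω : Type*} [MeasurableSpace Ω] {p : ℕ}

/-- The mean `μ = E X`. -/
def meanVec (P : Measure Ω) (X : Ω → EuclideanSpace ℝ (Fin p)) : EuclideanSpace ℝ (Fin p) :=
  ∫ ω, X ω ∂P

/-- The covariance matrix `Σ = Var X`. -/
def covMatrix (P : Measure Ω) (X : Ω → EuclideanSpace ℝ (Fin p)) : Matrix (Fin p) (Fin p) ℝ :=
  Matrix.of fun j k => cov[fun ω => X ω j, fun ω => X ω k; P]

/-- The weight `s(X, x) = 1 + (X - μ)ᵀ Σ⁻¹ (x - μ)`. -/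
def frechetWeight (P : Measure Ω) (X : Ω → EuclideanSpace ℝ (Fin p))
    (x : EuclideanSpace ℝ (Fin p)) (ω : Ω) : ℝ :=
  1 + ∑ j, ∑ k, (X ω j - meanVec P X j) * (covMatrix P X)⁻¹ j k * (x k - meanVec P X k)

/-- The global Fréchet regression objective `y ↦ E[s(X, x) d_{W₂}(Y, y)²]`. -/
def frechetObjective (P : Measure Ω) (S : Set ℝ) (X : Ω → EuclideanSpace ℝ (Fin p))
    (Y : Ω → Measure ℝ) (x : EuclideanSpace ℝ (Fin p)) (y : Measure ℝ) : ℝ :=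
  ∫ ω, frechetWeight P X x ω * wassersteinSq S (Y ω) y ∂P

/-- The σ-algebra generated by the covariate. -/
abbrev sigmaX (X : Ω → EuclideanSpace ℝ (Fin p)) : MeasurableSpace Ω :=
  MeasurableSpace.comap X inferInstance

/-- The global Fréchet regression model for a random distribution `Y` in the family `𝓕`, with
common compact support set `S`, on a covariate `X` in `[0, 1]^p`.  Here `F x` is the distribution
`F(· | x)`, and its quantile function is `Q(u | x) = E(Q_Y(u) | X = x) = α(u) + β(u)ᵀ (x - μ)`. -/
structure IsFrechetModel (P : Measure Ω) (S : Set ℝ) (𝓕 : Set (Measure ℝ))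
    (X : Ω → EuclideanSpace ℝ (Fin p)) (Y : Ω → Measure ℝ)
    (F : EuclideanSpace ℝ (Fin p) → Measure ℝ)
    (α : ℝ → ℝ) (β : ℝ → EuclideanSpace ℝ (Fin p)) : Prop where
  isCompact : IsCompact S
  family : ∀ y ∈ 𝓕, IsProbabilityMeasure y ∧ y Sᶜ = 0
  measurable_X : Measurable X
  measurable_Y : Measurable Y
  X_mem : ∀ᵐ ω ∂P, X ω ∈ unitCube p
  Y_mem : ∀ ω, Y ω ∈ 𝓕
  F_mem : ∀ x ∈ unitCube p, F x ∈ 𝓕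
  /-- `F(· | x)` minimizes the Fréchet objective, which is defined when `Σ` is invertible. -/
  isMin : IsUnit (covMatrix P X) →
    ∀ x ∈ unitCube p, IsMinOn (frechetObjective P S X Y x) 𝓕 (F x)
  /-- `Q(u | x) = E(Q_Y(u) | X = x)`. -/
  condMean : ∀ u ∈ Set.Icc (0 : ℝ) 1,
    P[fun ω => quantile S (Y ω) u | sigmaX X] =ᵐ[P] fun ω => quantile S (F (X ω)) u
  /-- `Q(u | x) = α(u) + β(u)ᵀ (x - μ)`. -/
  linear : ∀ x ∈ unitCube p, ∀ u ∈ Set.Icc (0 : ℝ) 1,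
    quantile S (F x) u = α u + ∑ j, β u j * (x j - meanVec P X j)

/-- The pseudo-error `ε(u) = Q_Y(u) - Q(u | X)`. -/
def pseudoError (S : Set ℝ) (X : Ω → EuclideanSpace ℝ (Fin p)) (Y : Ω → Measure ℝ)
    (F : EuclideanSpace ℝ (Fin p) → Measure ℝ) (u : ℝ) (ω : Ω) : ℝ :=
  quantile S (Y ω) u - quantile S (F (X ω)) u

/-- The optimal transport map `T(s) = Q_Y(F(s | X))` pushing `F(· | X)` forward to `Y`. -/
def transport (S : Set ℝ) (X : Ω → EuclideanSpace ℝ (Fin p)) (Y : Ω → Measure ℝ)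
    (F : EuclideanSpace ℝ (Fin p) → Measure ℝ) (s : ℝ) (ω : Ω) : ℝ :=
  quantile S (Y ω) (cdf (F (X ω)) s)

/-- `s ↦ F(s | μ)` is continuous and strictly increasing on `S`. -/
def RegularCenter (P : Measure Ω) (S : Set ℝ) (X : Ω → EuclideanSpace ℝ (Fin p))
    (F : EuclideanSpace ℝ (Fin p) → Measure ℝ) : Prop :=
  ContinuousOn (fun s => cdf (F (meanVec P X)) s) S ∧
    StrictMonoOn (fun s => cdf (F (meanVec P X)) s) S

/-- `E exp(t (ε(u) - ε(u'))) ≤ exp(t² |u - u'|² / 2)` for all real `t` and `u, u' ∈ [0, 1]`. -/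
def SubGaussianError (P : Measure Ω) (S : Set ℝ) (X : Ω → EuclideanSpace ℝ (Fin p))
    (Y : Ω → Measure ℝ) (F : EuclideanSpace ℝ (Fin p) → Measure ℝ) : Prop :=
  ∀ t : ℝ, ∀ u ∈ Set.Icc (0 : ℝ) 1, ∀ u' ∈ Set.Icc (0 : ℝ) 1,
    Integrable
      (fun ω => Real.exp (t * (pseudoError S X Y F u ω - pseudoError S X Y F u' ω))) P ∧
    ∫ ω, Real.exp (t * (pseudoError S X Y F u ω - pseudoError S X Y F u' ω)) ∂P
      ≤ Real.exp (t ^ 2 * |u - u'| ^ 2 / 2)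

/-- The conditional covariance `Cov(V, W | X)`. -/
def condCov (P : Measure Ω) (X : Ω → EuclideanSpace ℝ (Fin p)) (V W : Ω → ℝ) : Ω → ℝ :=
  P[fun ω => (V ω - (P[V | sigmaX X]) ω) * (W ω - (P[W | sigmaX X]) ω) | sigmaX X]

/-- The covariance function of `T` is continuous on `S × S` and equals the conditional
covariance function of `T` given `X`. -/
def HomogeneousCov (P : Measure Ω) (S : Set ℝ) (X : Ω → EuclideanSpace ℝ (Fin p))
    (Y : Ω → Measure ℝ) (F : EuclideanSpace ℝ (Fin p) → Measure ℝ) : Prop :=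
  ContinuousOn
    (fun q : ℝ × ℝ => cov[transport S X Y F q.1, transport S X Y F q.2; P]) (S ×ˢ S) ∧
  ∀ s ∈ S, ∀ s' ∈ S,
    condCov P X (transport S X Y F s) (transport S X Y F s')
      =ᵐ[P] fun _ => cov[transport S X Y F s, transport S X Y F s'; P]

/-- `(X₁, Y₁), (X₂, Y₂), …` is a random sample of `(X, Y)` (indexed from `0` below). -/
structure IsRandomSample (P : Measure Ω) (𝓕 : Set (Measure ℝ))
    (X : Ω → EuclideanSpace ℝ (Fin p)) (Y : Ω → Measure ℝ)
    (Xs : ℕ → Ω → EuclideanSpace ℝ (Fin p)) (Ys : ℕ → Ω → Measure ℝ) : Prop where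
  mem : ∀ i ω, Ys i ω ∈ 𝓕
  indep : iIndepFun (fun i ω => (Xs i ω, Ys i ω)) P
  identDistrib : ∀ i, IdentDistrib (fun ω => (Xs i ω, Ys i ω)) (fun ω => (X ω, Y ω)) P P

end Population

/-! ### Discretization and estimation -/

section Estimation

variable {p : ℕ}

/-- The grid points `u_m = m / M`; the index `m : Fin M` stands for the `(m + 1)`-st point. -/
def gridPoint (M : ℕ) (m : Fin M) : ℝ := ((m : ℝ) + 1) / M

/-- The `p × M` matrix with columns `β(u_1), …, β(u_M)`. -/
def discretize (β : ℝ → EuclideanSpace ℝ (Fin p)) (M : ℕ) : Matrix (Fin p) (Fin M) ℝ :=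
  Matrix.of fun j m => β (gridPoint M m) j

/-- The matrices of rank `r`. -/
def rankSet (p M r : ℕ) : Set (Matrix (Fin p) (Fin M) ℝ) := {B | B.rank = r}

/-- The Frobenius norm. -/
def frob {k l : ℕ} (A : Matrix (Fin k) (Fin l) ℝ) : ℝ := √(∑ i, ∑ j, A i j ^ 2)

/-- The scaled distance `M^{-1/2} ‖A - B‖_F` of two `p × M` matrices. -/
def scaledDist {M : ℕ} (A B : Matrix (Fin p) (Fin M) ℝ) : ℝ := frob (A - B) / √(M : ℝ)

/-- The centered `n × p` design matrix with entries `X_{i,j} - X̄_j`. -/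
def centeredDesign (x : ℕ → EuclideanSpace ℝ (Fin p)) (n : ℕ) : Matrix (Fin n) (Fin p) ℝ :=
  Matrix.of fun i j => x i j - (∑ k ∈ Finset.range n, x k j) / n

/-- The penalized least squares criterion
`∑ᵢ M⁻¹ ∑ₘ (Q_{Yᵢ}(u_m) - Q̄_Y(u_m) - ∑ⱼ b_{j,m} (X_{i,j} - X̄_j))² + lam J(B)`. -/
def criterion (S : Set ℝ) (x : ℕ → EuclideanSpace ℝ (Fin p)) (y : ℕ → Measure ℝ) (n M : ℕ)
    (lam : ℝ) (J : Matrix (Fin p) (Fin M) ℝ → ℝ) (B : Matrix (Fin p) (Fin M) ℝ) : ℝ :=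
  ∑ i : Fin n, 1 / (M : ℝ) * ∑ m : Fin M,
      (quantile S (y i) (gridPoint M m)
        - (∑ k ∈ Finset.range n, quantile S (y k) (gridPoint M m)) / n
        - ∑ j, B j m * centeredDesign x n i j) ^ 2
    + lam * J B

/-- `B` minimizes the criterion among the matrices of rank `r`. -/
def IsSolution (S : Set ℝ) (x : ℕ → EuclideanSpace ℝ (Fin p)) (y : ℕ → Measure ℝ) (n M r : ℕ)
    (lam : ℝ) (J : Matrix (Fin p) (Fin M) ℝ → ℝ) (B : Matrix (Fin p) (Fin M) ℝ) : Prop :=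
  B ∈ rankSet p M r ∧ IsMinOn (criterion S x y n M lam J) (rankSet p M r) B

/-- The `k`-th column (`k = 1, …, M`) of `B` as a vector; the index is clamped to `{1, …, M}`. -/
def column {M : ℕ} (B : Matrix (Fin p) (Fin M) ℝ) (k : ℕ) : EuclideanSpace ℝ (Fin p) :=
  WithLp.toLp 2 fun j => if h : min (k - 1) (M - 1) < M then B j ⟨min (k - 1) (M - 1), h⟩ else 0

/-- The piecewise linear function on `[0, 1]` interpolating the columns of `B` at
`u_1, …, u_M`; to the left of `u_1` it is constant. -/
def interpolate {M : ℕ} (B : Matrix (Fin p) (Fin M) ℝ) (u : ℝ) : EuclideanSpace ℝ (Fin p) :=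
  (1 - Int.fract (u * M)) • column B ⌊u * M⌋₊ + Int.fract (u * M) • column B (⌊u * M⌋₊ + 1)

/-- The distance in `L²([0, 1]; ℝ^p)`. -/
def l2Dist (f g : ℝ → EuclideanSpace ℝ (Fin p)) : ℝ :=
  √(∫ u in (0 : ℝ)..1, ‖f u - g u‖ ^ 2)

/-- A penalty function on `p × m` matrices, for every `m`: nonnegative, zero at `0` and
continuous there. -/
structure IsPenalty (J : (m : ℕ) → Matrix (Fin p) (Fin m) ℝ → ℝ) : Prop where
  nonneg : ∀ m B, 0 ≤ J m B
  zero : ∀ m, J m 0 = 0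
  continuousAt : ∀ m, ContinuousAt (J m) 0

/-- Local Lipschitz condition on the penalty along the grids of sizes `M n`: for all `ε > 0`, and
on every bounded neighbourhood (radius `ρ`) of the true matrix `B*`, there is `C > 0` with
`M^{-1/2} ‖B - B*‖_F > ε ⇒ |J(B) - J(B*)| ≤ C M^{-1/2} ‖B - B*‖_F` for `B` of rank `r`. -/
def PenaltyCondition (β : ℝ → EuclideanSpace ℝ (Fin p)) (r : ℕ) (M : ℕ → ℕ)
    (J : (m : ℕ) → Matrix (Fin p) (Fin m) ℝ → ℝ) : Prop :=
  ∀ ε > 0, ∀ ρ > 0, ∃ C > 0, ∀ n, ∀ B ∈ rankSet p (M n) r,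
    scaledDist B (discretize β (M n)) ≤ ρ →
    ε < scaledDist B (discretize β (M n)) →
      |J (M n) B - J (M n) (discretize β (M n))| ≤ C * scaledDist B (discretize β (M n))

end Estimation

/-! ### Stochastic order -/

section Order

variable {Ω : Type*} [MeasurableSpace Ω]

/-- The events `A n` hold with probability tending to one (`P` of a set that need not be
measurable is its outer measure). -/
def WithHighProb (P : Measure Ω) (A : ℕ → Set Ω) : Prop :=
  Tendsto (fun n => P (A n)ᶜ) atTop (𝓝 0)

/-- `R n = O_P(a n)`. -/
def IsBigOP (P : Measure Ω) (R : ℕ → Ω → ℝ) (a : ℕ → ℝ) : Prop :=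
  ∀ δ : ℝ, 0 < δ → ∃ K : ℝ, 0 < K ∧
    ∀ᶠ n in atTop, P {ω | K * a n < |R n ω|} ≤ ENNReal.ofReal δ

/-- Restricted strong convexity: for all `ε > 0` there is `c > 0` such that, with probability
tending to one, `M^{-1/2} ‖B - B*‖_F ≥ ε ⇒ n⁻¹ ‖X̃ (B - B*)‖_F² ≥ c² ‖B - B*‖_F²` for all `B` of
rank `r`. -/
def RestrictedConvexity {p : ℕ} (P : Measure Ω) (Xs : ℕ → Ω → EuclideanSpace ℝ (Fin p))
    (β : ℝ → EuclideanSpace ℝ (Fin p)) (r : ℕ) (M : ℕ → ℕ) : Prop :=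
  ∀ ε > 0, ∃ c > 0, WithHighProb P fun n =>
    {ω | ∀ B ∈ rankSet p (M n) r, ε ≤ scaledDist B (discretize β (M n)) →
      c ^ 2 * frob (B - discretize β (M n)) ^ 2
        ≤ (n : ℝ)⁻¹ * frob (centeredDesign (fun i => Xs i ω) n
            * (B - discretize β (M n))) ^ 2}

end Order

end FrechetQuantile

end

/-! With `p` and the law fixed, the estimator attains the rate `√(1/n) + √(lam/n)` in scaled
Frobenius distance, and this is dominated by the stated one as soon as `r ≥ 1`; for `r = 0` both
matrices vanish.

Comparing the criterion at the estimator and at the truth `B*` (`IsSolution.basic_inequality`)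
bounds `‖X̃(B - B*)‖²` by twice a noise inner product plus `M lam J(B*)`. Three facts turn this into
a rate.

Convexity: the condition is given only at a distance from `B*`, so it does not control an estimator
close to `B*`. But adding multiples of one nonzero row of `B*` to its rows is, for a suitable
multiple, an invertible operation that keeps the rank and moves arbitrarily far. This tests the
design on every vector, hence gives the lower bound for all matrices (`le_frob_mul_of_restricted`),
and no preliminary consistency is needed.

Penalty: `J(B*)` must be bounded uniformly in `n`. The matrix `t B*` with small `t > 0` has rank `r`
and penalty below one, and its distance to `B*` is bounded above and away from zero, so the
Lipschitz condition carries the bound to `B*` (`exists_penalty_le`). The uniform lower bound on `B*`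
comes from left-continuity of `β` (`exists_le_frob_discretize`).

Noise: the grid errors are bounded, centered and uncorrelated with the covariates, so `‖X̃ᵀE‖²` has
mean of order `Mn`, and Markov's inequality applies (`exists_design_noise_bound`).

Interpolation multiplies the scaled distance by at most `3`, and bounded variation of `β` adds a
deterministic term of order `M^{-1/2}` (`l2Dist_interpolate_le`). -/

namespace FrechetQuantile

/-! ### Quantile functions on a compact support. -/

section Quantile

variable {S : Set ℝ} {y : Measure ℝ} [IsProbabilityMeasure y] {u : ℝ}

theorem nonempty_of_support (hy : y Sᶜ = 0) : S.Nonempty := by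
  rcases S.eq_empty_or_nonempty with h | h
  · simp [h] at hy
  · exact h

theorem quantileSet_nonempty (hS : IsCompact S) (hy : y Sᶜ = 0) (hu : u ≤ 1) :
    {s : ℝ | s ∈ S ∧ u ≤ cdf y s}.Nonempty := by
  obtain ⟨t, htS, ht⟩ := hS.exists_isGreatest (nonempty_of_support hy)
  refine ⟨t, htS, ?_⟩
  have h : y.real (Set.Iic t) = 1 := by
    rw [measureReal_def, (prob_compl_eq_zero_iff measurableSet_Iic).1, ENNReal.toReal_one]
    exact measure_mono_null (Set.compl_subset_compl.2 fun s hs => ht hs) hy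
  rwa [cdf_eq_real, h]

theorem quantileSet_bddBelow (hS : IsCompact S) (y : Measure ℝ) (u : ℝ) :
    BddBelow {s : ℝ | s ∈ S ∧ u ≤ cdf y s} :=
  hS.bddBelow.mono fun _ hs => hs.1

/-- Right-continuity of the distribution function passes the inequality from points above the
infimum to the infimum itself. -/
theorem le_cdf_quantile (hS : IsCompact S) (hy : y Sᶜ = 0) (hu : u ≤ 1) :
    u ≤ cdf y (quantile S y u) := by
  have hne := quantileSet_nonempty hS hy hu
  have hc := ((cdf y).right_continuous (quantile S y u)).tendsto.mono_left
    (nhdsWithin_mono _ Set.Ioi_subset_Ici_self)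
  refine ge_of_tendsto hc ?_
  filter_upwards [self_mem_nhdsWithin] with t ht
  obtain ⟨s, hs, hst⟩ := exists_lt_of_csInf_lt hne ht
  exact hs.2.trans (monotone_cdf y hst.le)

/-- The Galois connection between quantile function and distribution function. -/
theorem quantile_le_iff (hS : IsCompact S) (hy : y Sᶜ = 0) (hu0 : 0 < u) (hu : u ≤ 1) {t : ℝ} :
    quantile S y u ≤ t ↔ u ≤ cdf y t := by
  refine ⟨fun h => (le_cdf_quantile hS hy hu).trans (monotone_cdf y h), fun h => ?_⟩
  have hnull : ∀ A : Set ℝ, A ⊆ Sᶜ → y A = 0 := fun A hA => measure_mono_null hA hy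
  -- This is where `0 < u` is needed: without support points up to `t` the distribution function
  -- would be zero there.
  have hne : (S ∩ Set.Iic t).Nonempty := by
    by_contra hcon
    rw [Set.not_nonempty_iff_eq_empty] at hcon
    have h0 : y (Set.Iic t) = 0 := hnull _ fun s hs hsS => by
      have : s ∈ S ∩ Set.Iic t := ⟨hsS, hs⟩
      simp [hcon] at this
    rw [cdf_eq_real, measureReal_def, h0, ENNReal.toReal_zero] at h
    linarith
  -- The last support point `t'` up to `t` competes in the infimum, since `(t', t]` misses `S` and
  -- carries no mass.
  obtain ⟨t', ⟨htS, htt⟩, ht'⟩ := (hS.inter_right isClosed_Iic).exists_isGreatest hne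
  refine (csInf_le (quantileSet_bddBelow hS y u) ⟨htS, h.trans ?_⟩).trans htt
  rw [cdf_eq_real, cdf_eq_real, measureReal_def, measureReal_def]
  refine ENNReal.toReal_mono (measure_ne_top _ _) ?_
  calc y (Set.Iic t) ≤ y (Set.Iic t' ∪ Sᶜ) := by
        refine measure_mono fun s hs => ?_
        by_cases hsS : s ∈ S
        · exact Or.inl (ht' ⟨hsS, hs⟩)
        · exact Or.inr hsS
    _ ≤ y (Set.Iic t') + y Sᶜ := measure_union_le _ _
    _ = y (Set.Iic t') := by rw [hy, add_zero]

theorem abs_quantile_le (hS : IsCompact S) (hy : y Sᶜ = 0) (hu : u ≤ 1) {K : ℝ}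
    (hK : ∀ s ∈ S, |s| ≤ K) : |quantile S y u| ≤ K := by
  have hne := quantileSet_nonempty hS hy hu
  refine abs_le.2 ⟨le_csInf hne fun s hs => (abs_le.1 (hK s hs.1)).1, ?_⟩
  obtain ⟨s, hs⟩ := hne
  exact (csInf_le (quantileSet_bddBelow hS y u) hs).trans (abs_le.1 (hK s hs.1)).2

theorem monotoneOn_quantile (hS : IsCompact S) (hy : y Sᶜ = 0) :
    MonotoneOn (quantile S y) (Set.Iic 1) := by
  intro u _ v hv huv
  exact csInf_le_csInf (quantileSet_bddBelow hS y u) (quantileSet_nonempty hS hy hv)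
    fun s hs => ⟨hs.1, huv.trans hs.2⟩

/-- By the Galois connection, `t < Q(u)` means `cdf y t < u`, an open condition on `u`; monotonicity
gives the other side. -/
theorem tendsto_quantile_left (hS : IsCompact S) (hy : y Sᶜ = 0) (hu0 : 0 < u) (hu : u ≤ 1) :
    Tendsto (quantile S y) (𝓝[≤] u) (𝓝 (quantile S y u)) := by
  refine tendsto_order.2 ⟨fun t ht => ?_, fun t ht => ?_⟩
  · have h : cdf y t < u := by
      by_contra hcon
      exact absurd ((quantile_le_iff hS hy hu0 hu).2 (not_lt.1 hcon)) (not_le.2 ht)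
    filter_upwards [self_mem_nhdsWithin, mem_nhdsWithin_of_mem_nhds (Ioi_mem_nhds h)] with v hv hv'
    have hv0 : 0 < v := (cdf_nonneg y t).trans_lt hv'
    by_contra hcon
    exact absurd ((quantile_le_iff hS hy hv0 (le_trans hv hu)).1 (not_lt.1 hcon)) (not_le.2 hv')
  · filter_upwards [self_mem_nhdsWithin] with v hv
    exact (monotoneOn_quantile hS hy (le_trans hv hu) hu hv).trans_lt ht

end Quantile

/-- On a family of distributions on a compact set, a quantile is a measurable function. -/
theorem exists_measurable_quantile {S : Set ℝ} (hS : IsCompact S) {𝓕 : Set (Measure ℝ)}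
    (h𝓕 : ∀ y ∈ 𝓕, IsProbabilityMeasure y ∧ y Sᶜ = 0) {u : ℝ} (hu0 : 0 < u) (hu : u ≤ 1) :
    ∃ q : Measure ℝ → ℝ, Measurable q ∧ ∀ y ∈ 𝓕, q y = quantile S y u := by
  have hm : Measurable fun y : 𝓕 => quantile S (y : Measure ℝ) u := by
    refine measurable_of_Iic fun t => ?_
    have : (fun y : 𝓕 => quantile S (y : Measure ℝ) u) ⁻¹' Set.Iic t
        = {y : 𝓕 | u ≤ ((y : Measure ℝ) (Set.Iic t)).toReal} := by
      ext ⟨y, hy⟩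
      have := (h𝓕 y hy).1
      simp only [Set.mem_preimage, Set.mem_Iic, Set.mem_ofPred_eq]
      rw [quantile_le_iff hS (h𝓕 y hy).2 hu0 hu, cdf_eq_real, measureReal_def]
    rw [this]
    exact measurableSet_le measurable_const
      ((Measure.measurable_coe measurableSet_Iic).comp measurable_subtype_coe).ennreal_toReal
  -- `𝓕` need not be measurable, so the function is not extended by a constant; it factors through
  -- the coercion because the subtype carries the pulled-back σ-algebra.
  obtain ⟨q, hq, hqe⟩ := Measurable.exists_eq_measurable_comp
    (f := ((↑) : 𝓕 → Measure ℝ)) (g := fun y : 𝓕 => quantile S (y : Measure ℝ) u) hm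
  exact ⟨q, hq, fun y hy => (congrFun hqe ⟨y, hy⟩).symm⟩


/-! ### The Frobenius norm. -/

section Frobenius

variable {k l : ℕ}

theorem frob_nonneg (A : Matrix (Fin k) (Fin l) ℝ) : 0 ≤ frob A := Real.sqrt_nonneg _

theorem frob_sq (A : Matrix (Fin k) (Fin l) ℝ) : frob A ^ 2 = ∑ i, ∑ j, A i j ^ 2 :=
  Real.sq_sqrt (Finset.sum_nonneg fun _ _ => Finset.sum_nonneg fun _ _ => sq_nonneg _)

theorem frob_smul (t : ℝ) (A : Matrix (Fin k) (Fin l) ℝ) : frob (t • A) = |t| * frob A := by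
  rw [frob, frob, ← Real.sqrt_sq_eq_abs, ← Real.sqrt_mul (sq_nonneg t)]
  simp [Finset.mul_sum, mul_pow]

theorem frob_eq_zero {A : Matrix (Fin k) (Fin l) ℝ} (h : frob A = 0) : A = 0 := by
  have h2 := frob_sq A
  rw [h, zero_pow two_ne_zero] at h2
  ext i j
  have h3 := (Finset.sum_eq_zero_iff_of_nonneg
    fun _ _ => Finset.sum_nonneg fun _ _ => sq_nonneg _).1 h2.symm i (Finset.mem_univ i)
  have h4 := (Finset.sum_eq_zero_iff_of_nonneg fun _ _ => sq_nonneg _).1 h3 j (Finset.mem_univ j)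
  exact pow_eq_zero_iff two_ne_zero |>.1 h4

theorem frob_pos {A : Matrix (Fin k) (Fin l) ℝ} (h : A ≠ 0) : 0 < frob A :=
  (frob_nonneg A).lt_of_ne fun h0 => h (frob_eq_zero h0.symm)

theorem sum_mul_le_frob_mul_frob (A B : Matrix (Fin k) (Fin l) ℝ) :
    ∑ i, ∑ j, A i j * B i j ≤ frob A * frob B := by
  have h := Real.sum_mul_le_sqrt_mul_sqrt (Finset.univ : Finset (Fin k × Fin l))
    (fun q => A q.1 q.2) (fun q => B q.1 q.2)
  simpa only [Fintype.sum_prod_type, frob] using h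

theorem frob_vecMulVec_sq (v : Fin k → ℝ) (w : Fin l → ℝ) :
    frob (Matrix.vecMulVec v w) ^ 2 = (∑ i, v i ^ 2) * ∑ j, w j ^ 2 := by
  rw [frob_sq, Finset.sum_mul_sum]
  simp [Matrix.vecMulVec_apply, mul_pow]

end Frobenius

/-! ### Design lower bound, basic inequality and noise term. -/

section Matrices

variable {n p M : ℕ}

theorem isUnit_det_one_add_vecMulVec (a b : Fin p → ℝ) (h : 0 ≤ b ⬝ᵥ a) :
    IsUnit (1 + Matrix.vecMulVec a b).det := by
  rw [Matrix.vecMulVec_eq Unit, Matrix.det_one_add_replicateCol_mul_replicateRow]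
  exact (show (1 : ℝ) + b ⬝ᵥ a ≠ 0 by linarith).isUnit

/-- Restricted convexity far away from `B₀ ≠ 0` is a lower bound for the design itself. -/
theorem le_frob_mul_of_restricted {κ c : ℝ}
    (D : Matrix (Fin n) (Fin p) ℝ) {B₀ : Matrix (Fin p) (Fin M) ℝ} (hB₀ : B₀ ≠ 0)
    (h : ∀ B : Matrix (Fin p) (Fin M) ℝ, B.rank = B₀.rank → 1 ≤ scaledDist B B₀ →
      c ^ 2 * frob (B - B₀) ^ 2 ≤ κ * frob (D * (B - B₀)) ^ 2)
    (A : Matrix (Fin p) (Fin M) ℝ) : c ^ 2 * frob A ^ 2 ≤ κ * frob (D * A) ^ 2 := by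
  have hvec : ∀ v : Fin p → ℝ, c ^ 2 * ∑ j, v j ^ 2 ≤ κ * ∑ i, D.mulVec v i ^ 2 := by
    intro v
    by_cases hv : v = 0
    · simp [hv]
    obtain ⟨i₀, hi₀⟩ : ∃ i, B₀ i ≠ 0 := by
      by_contra hcon
      push Not at hcon
      exact hB₀ (by ext i j; simp [hcon i])
    obtain ⟨m₀, hm₀⟩ : ∃ m, B₀ i₀ m ≠ 0 := by
      by_contra hcon
      push Not at hcon
      exact hi₀ (by ext j; simp [hcon j])
    have hM : 0 < M := m₀.pos
    have hG : Matrix.vecMulVec v (B₀ i₀) ≠ 0 := by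
      obtain ⟨j, hj⟩ := Function.ne_iff.1 hv
      intro h0
      have := congrFun (congrFun h0 j) m₀
      rw [Matrix.vecMulVec_apply, Matrix.zero_apply] at this
      exact (mul_ne_zero hj hm₀) this
    have hG0 := frob_pos hG
    -- The size of `t` puts the perturbed matrix at scaled distance at least one; its sign keeps the
    -- determinant `1 + t * v i₀` of the row operation nonzero.
    obtain ⟨t, ht, hdist⟩ : ∃ t : ℝ, 0 ≤ t * v i₀ ∧
        √(M : ℝ) ≤ |t| * frob (Matrix.vecMulVec v (B₀ i₀)) := by
      set q := √(M : ℝ) / frob (Matrix.vecMulVec v (B₀ i₀)) with hq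
      have hq0 : 0 ≤ q := by positivity
      have hqq : q * frob (Matrix.vecMulVec v (B₀ i₀)) = √(M : ℝ) :=
        div_mul_cancel₀ _ hG0.ne'
      rcases le_total 0 (v i₀) with h0 | h0
      · exact ⟨q, mul_nonneg hq0 h0, by rw [abs_of_nonneg hq0, hqq]⟩
      · exact ⟨-q, by nlinarith, by rw [abs_neg, abs_of_nonneg hq0, hqq]⟩
    set B := (1 + Matrix.vecMulVec (t • v) (Pi.single i₀ 1)) * B₀ with hB
    have hrow : Matrix.vecMulVec (t • v) (Pi.single i₀ 1) * B₀
        = t • Matrix.vecMulVec v (B₀ i₀) := by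
      rw [Matrix.vecMulVec_mul, Matrix.single_one_vecMul, Matrix.smul_vecMulVec]
      rfl
    have hdiff : B - B₀ = t • Matrix.vecMulVec v (B₀ i₀) := by
      rw [hB, Matrix.add_mul, Matrix.one_mul, hrow, add_sub_cancel_left]
    have hrk : B.rank = B₀.rank :=
      Matrix.rank_mul_eq_right_of_isUnit_det _ _
        (isUnit_det_one_add_vecMulVec _ _ (by simpa using ht))
    have hd : 1 ≤ scaledDist B B₀ := by
      rw [scaledDist, hdiff, frob_smul, le_div_iff₀ (by positivity), one_mul]
      exact hdist
    have hmain := h B hrk hd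
    rw [hdiff, Matrix.mul_smul, Matrix.mul_vecMulVec, frob_smul, frob_smul, mul_pow, mul_pow,
      frob_vecMulVec_sq, frob_vecMulVec_sq] at hmain
    have ht0 : t ≠ 0 := by
      rintro rfl
      rw [abs_zero, zero_mul] at hdist
      have : 0 < √(M : ℝ) := by positivity
      linarith
    have hw : 0 < ∑ j, B₀ i₀ j ^ 2 :=
      Finset.sum_pos' (fun _ _ => sq_nonneg _) ⟨m₀, Finset.mem_univ _, by positivity⟩
    have hpos : 0 < |t| ^ 2 * ∑ j, B₀ i₀ j ^ 2 := by positivity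
    refine le_of_mul_le_mul_right ?_ hpos
    linarith
  -- Squared Frobenius norms add over columns, so the vector inequality applied to each column of
  -- `A` suffices, whatever its rank.
  have hcol : ∀ {k : ℕ} (G : Matrix (Fin k) (Fin M) ℝ),
      frob G ^ 2 = ∑ m, ∑ i, G i m ^ 2 := fun G => by rw [frob_sq, Finset.sum_comm]
  rw [hcol, hcol, Finset.mul_sum, Finset.mul_sum]
  refine Finset.sum_le_sum fun m _ => ?_
  exact hvec fun j => A j m

theorem sum_centeredDesign (x : ℕ → EuclideanSpace ℝ (Fin p)) (n : ℕ) (j : Fin p) :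
    ∑ i, centeredDesign x n i j = 0 := by
  rcases Nat.eq_zero_or_pos n with rfl | hn
  · simp
  · have : (n : ℝ) ≠ 0 := by positivity
    simp only [centeredDesign, Matrix.of_apply, Finset.sum_sub_distrib, Finset.sum_const,
      Finset.card_univ, Fintype.card_fin, nsmul_eq_mul]
    rw [mul_div_cancel₀ _ this, Fin.sum_univ_eq_sum_range (fun k => x k j), sub_self]

theorem sum_mul_mul_eq_transpose (D : Matrix (Fin n) (Fin p) ℝ) (A : Matrix (Fin p) (Fin M) ℝ)
    (E : Matrix (Fin n) (Fin M) ℝ) :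
    ∑ i, ∑ m, E i m * (D * A) i m = ∑ j, ∑ m, A j m * (D.transpose * E) j m := by
  simp only [Matrix.mul_apply, Matrix.transpose_apply, Finset.mul_sum]
  calc ∑ i, ∑ m, ∑ j, E i m * (D i j * A j m)
      = ∑ i, ∑ j, ∑ m, E i m * (D i j * A j m) :=
        Finset.sum_congr rfl fun i _ => Finset.sum_comm
    _ = ∑ j, ∑ i, ∑ m, E i m * (D i j * A j m) := Finset.sum_comm
    _ = ∑ j, ∑ m, ∑ i, E i m * (D i j * A j m) :=
        Finset.sum_congr rfl fun j _ => Finset.sum_comm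
    _ = _ := by
        refine Finset.sum_congr rfl fun j _ => Finset.sum_congr rfl fun m _ =>
          Finset.sum_congr rfl fun i _ => ?_
        ring

/-- The basic inequality for the penalized least squares estimator. -/
theorem IsSolution.basic_inequality {S : Set ℝ} {x : ℕ → EuclideanSpace ℝ (Fin p)}
    {y : ℕ → Measure ℝ} {r : ℕ} {lam : ℝ} {J : Matrix (Fin p) (Fin M) ℝ → ℝ}
    {B B₀ : Matrix (Fin p) (Fin M) ℝ} (hB : IsSolution S x y n M r lam J B)
    (hB₀ : B₀ ∈ rankSet p M r) (hM : 0 < M) (hlam : 0 ≤ lam) (hJ : 0 ≤ J B)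
    (a : Fin M → ℝ) (e : ℕ → Fin M → ℝ)
    (hy : ∀ i m, quantile S (y i) (gridPoint M m) = a m + ∑ j, B₀ j m * x i j + e i m) :
    frob (centeredDesign x n * (B - B₀)) ^ 2 ≤
      2 * (frob (B - B₀) *
        frob ((centeredDesign x n).transpose * Matrix.of fun (i : Fin n) m => e i m))
      + M * (lam * J B₀) := by
  set D := centeredDesign x n with hD
  set E : Matrix (Fin n) (Fin M) ℝ := Matrix.of fun (i : Fin n) m => e i m with hE
  set eb : Fin M → ℝ := fun m => (∑ k ∈ Finset.range n, e k m) / n with heb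
  -- Centering removes the intercept `a`, leaving centered noise minus the deviation from `B₀`.
  have hres : ∀ (A : Matrix (Fin p) (Fin M) ℝ) (i : Fin n) (m : Fin M),
      quantile S (y i) (gridPoint M m)
        - (∑ k ∈ Finset.range n, quantile S (y k) (gridPoint M m)) / n
        - ∑ j, A j m * D i j = (E i m - eb m) - (D * (A - B₀)) i m := by
    intro A i m
    have hn : (n : ℝ) ≠ 0 := by
      have : 0 < n := i.pos
      positivity
    have h1 : (∑ k ∈ Finset.range n, quantile S (y k) (gridPoint M m)) / n
        = a m + ∑ j, B₀ j m * ((∑ k ∈ Finset.range n, x k j) / n) + eb m := by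
      simp only [hy, Finset.sum_add_distrib, Finset.sum_const, Finset.card_range, nsmul_eq_mul, heb]
      rw [Finset.sum_comm]
      simp only [← Finset.mul_sum, add_div, mul_div_cancel_left₀ _ hn, Finset.sum_div, mul_div_assoc]
    have h2 : (D * (A - B₀)) i m = ∑ j, A j m * D i j
        - (∑ j, B₀ j m * x i j - ∑ j, B₀ j m * ((∑ k ∈ Finset.range n, x k j) / n)) := by
      rw [Matrix.mul_apply, ← Finset.sum_sub_distrib, ← Finset.sum_sub_distrib]
      refine Finset.sum_congr rfl fun j _ => ?_
      simp only [hD, centeredDesign, Matrix.of_apply, Matrix.sub_apply]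
      ring
    rw [h1, h2, hy]
    simp only [hE, Matrix.of_apply]
    ring
  have hcrit : ∀ A, criterion S x y n M lam J A
      = 1 / (M : ℝ) * (∑ i, ∑ m, ((E i m - eb m) - (D * (A - B₀)) i m) ^ 2) + lam * J A := by
    intro A
    rw [criterion, Finset.mul_sum]
    simp only [← hD, hres]
  have hmin := hB.2 hB₀
  simp only [Set.mem_ofPred_eq, hcrit, sub_self, Matrix.mul_zero, Matrix.zero_apply, sub_zero] at hmin
  have hexp : ∑ i, ∑ m, ((E i m - eb m) - (D * (B - B₀)) i m) ^ 2
      = ∑ i, ∑ m, (E i m - eb m) ^ 2 - 2 * ∑ i, ∑ m, (E i m - eb m) * (D * (B - B₀)) i m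
        + frob (D * (B - B₀)) ^ 2 := by
    rw [frob_sq, Finset.mul_sum, ← Finset.sum_sub_distrib, ← Finset.sum_add_distrib]
    refine Finset.sum_congr rfl fun i _ => ?_
    rw [Finset.mul_sum, ← Finset.sum_sub_distrib, ← Finset.sum_add_distrib]
    exact Finset.sum_congr rfl fun m _ => by ring
  -- The columns of the centered design sum to zero, so the averaged noise is orthogonal to the fit.
  have hcenter : ∑ i, ∑ m, (E i m - eb m) * (D * (B - B₀)) i m
      = ∑ i, ∑ m, E i m * (D * (B - B₀)) i m := by
    have h0 : ∑ i, ∑ m, eb m * (D * (B - B₀)) i m = 0 := by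
      rw [Finset.sum_comm]
      refine Finset.sum_eq_zero fun m _ => ?_
      rw [← Finset.mul_sum]
      simp only [Matrix.mul_apply]
      rw [Finset.sum_comm]
      simp [← Finset.sum_mul, hD, sum_centeredDesign]
    simp only [sub_mul, Finset.sum_sub_distrib, h0, sub_zero]
  have hcs := sum_mul_le_frob_mul_frob (B - B₀) (D.transpose * E)
  rw [← sum_mul_mul_eq_transpose, ← hcenter] at hcs
  rw [hexp] at hmin
  have hM' : (0 : ℝ) < M := by positivity
  have hlJ : 0 ≤ lam * J B := mul_nonneg hlam hJ
  set T := ∑ i, ∑ m, (E i m - eb m) ^ 2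
  set U := ∑ i, ∑ m, (E i m - eb m) * (D * (B - B₀)) i m
  set W := frob (D * (B - B₀)) ^ 2
  have h3 : 1 / (M : ℝ) * (W - 2 * U) ≤ lam * J B₀ := by
    have : 1 / (M : ℝ) * (T - 2 * U + W) = 1 / (M : ℝ) * T + 1 / (M : ℝ) * (W - 2 * U) := by ring
    linarith
  rw [one_div, inv_mul_le_iff₀ hM'] at h3
  linarith

/-- The covariate mean depends on the whole sample, so the centered products are not sums of
independent terms. Since it lies in `[0, 1]`, splitting it off leaves two sums of independent terms
in the application. -/
theorem frob_design_noise_sq_le {x : ℕ → EuclideanSpace ℝ (Fin p)}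
    (hx : ∀ i, x i ∈ unitCube p) (e : ℕ → Fin M → ℝ) (n : ℕ) :
    frob ((centeredDesign x n).transpose * Matrix.of fun (i : Fin n) m => e i m) ^ 2 ≤
      ∑ j, ∑ m, (2 * (∑ i ∈ Finset.range n, x i j * e i m) ^ 2
        + 2 * (∑ i ∈ Finset.range n, e i m) ^ 2) := by
  rw [frob_sq]
  refine Finset.sum_le_sum fun j _ => Finset.sum_le_sum fun m _ => ?_
  set b := (∑ k ∈ Finset.range n, x k j) / n with hb
  have hb0 : 0 ≤ b := div_nonneg (Finset.sum_nonneg fun k _ => (hx k j).1) (Nat.cast_nonneg n)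
  have hb1 : b ≤ 1 := by
    refine div_le_one_of_le₀ ?_ (Nat.cast_nonneg n)
    calc ∑ k ∈ Finset.range n, x k j ≤ ∑ _k ∈ Finset.range n, (1 : ℝ) :=
          Finset.sum_le_sum fun k _ => (hx k j).2
      _ = n := by simp
  have heq : ((centeredDesign x n).transpose * Matrix.of fun (i : Fin n) m => e i m) j m
      = ∑ i ∈ Finset.range n, x i j * e i m - b * ∑ i ∈ Finset.range n, e i m := by
    rw [Matrix.mul_apply, Finset.mul_sum, ← Finset.sum_sub_distrib, ← Fin.sum_univ_eq_sum_range
      (fun i => x i j * e i m - b * e i m)]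
    refine Finset.sum_congr rfl fun i _ => ?_
    simp only [Matrix.transpose_apply, centeredDesign, Matrix.of_apply, ← hb]
    ring
  rw [heq]
  set s := ∑ i ∈ Finset.range n, x i j * e i m
  set q := ∑ i ∈ Finset.range n, e i m
  have h1 : (b * q) ^ 2 ≤ q ^ 2 := by
    rw [mul_pow]
    exact mul_le_of_le_one_left (sq_nonneg q) (pow_le_one₀ hb0 hb1)
  linarith [sq_nonneg (s + b * q), sq_nonneg (s - b * q)]

end Matrices


/-! ### Step functions on the grid and the interpolation error. -/

theorem floor_mul_eq {M k : ℕ} (hM : 0 < M) {u : ℝ} (h0 : (k : ℝ) / M ≤ u)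
    (h1 : u < ((k + 1 : ℕ) : ℝ) / M) : ⌊u * M⌋₊ = k := by
  have hM' : (0 : ℝ) < M := by positivity
  rw [div_le_iff₀ hM'] at h0
  rw [lt_div_iff₀ hM'] at h1
  refine (Nat.floor_eq_iff (le_trans (Nat.cast_nonneg k) h0)).2 ⟨h0, ?_⟩
  exact_mod_cast h1

/-- Interval integrals use cells closed on the right, the floor uses cells closed on the left; the
exceptional right endpoint is a null set. -/
theorem floor_comp_ae_eq {M : ℕ} (hM : 0 < M) (g : ℕ → ℝ) (k : ℕ) :
    ∀ᵐ u : ℝ, u ∈ Set.uIoc ((k : ℝ) / M) (((k + 1 : ℕ) : ℝ) / M) → g k = g ⌊u * M⌋₊ := by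
  have hM' : (0 : ℝ) < M := by positivity
  have hle : (k : ℝ) / M ≤ ((k + 1 : ℕ) : ℝ) / M := by gcongr; simp
  filter_upwards [compl_mem_ae_iff.2 (measure_singleton (((k + 1 : ℕ) : ℝ) / M))] with u hu hmem
  rw [Set.uIoc_of_le hle] at hmem
  rw [floor_mul_eq hM hmem.1.le (lt_of_le_of_ne hmem.2 hu)]

theorem intervalIntegrable_floor_comp_piece {M : ℕ} (hM : 0 < M) (g : ℕ → ℝ) (k : ℕ) :
    IntervalIntegrable (fun u : ℝ => g ⌊u * M⌋₊) volume ((k : ℝ) / M) (((k + 1 : ℕ) : ℝ) / M) :=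
  (intervalIntegrable_const (c := g k)).congr_ae
    ((ae_restrict_iff' measurableSet_uIoc).2 (floor_comp_ae_eq hM g k))

theorem intervalIntegrable_floor_comp {M : ℕ} (hM : 0 < M) (g : ℕ → ℝ) :
    IntervalIntegrable (fun u : ℝ => g ⌊u * M⌋₊) volume 0 1 := by
  have h := IntervalIntegrable.trans_iterate (a := fun k : ℕ => (k : ℝ) / M) (n := M)
    fun k _ => intervalIntegrable_floor_comp_piece hM g k
  have hM' : (M : ℝ) ≠ 0 := by positivity
  simpa [div_self hM'] using h

theorem integral_floor_comp {M : ℕ} (hM : 0 < M) (g : ℕ → ℝ) :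
    ∫ u in (0 : ℝ)..1, g ⌊u * M⌋₊ = (∑ k ∈ Finset.range M, g k) / M := by
  have h := intervalIntegral.sum_integral_adjacent_intervals (a := fun k : ℕ => (k : ℝ) / M)
    (n := M) fun k _ => intervalIntegrable_floor_comp_piece hM g k
  have hM' : (M : ℝ) ≠ 0 := by positivity
  simp only [Nat.cast_zero, zero_div, div_self hM'] at h
  rw [← h, Finset.sum_div]
  refine Finset.sum_congr rfl fun k _ => ?_
  rw [← intervalIntegral.integral_congr_ae (floor_comp_ae_eq hM g k),
    intervalIntegral.integral_const, smul_eq_mul]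
  push_cast
  ring

variable {p M : ℕ}

theorem column_sub (A B : Matrix (Fin p) (Fin M) ℝ) (k : ℕ) :
    column (A - B) k = column A k - column B k := by
  ext j
  simp only [column, PiLp.sub_apply]
  split_ifs <;> simp

theorem column_succ_apply (A : Matrix (Fin p) (Fin M) ℝ) (m : Fin M) (j : Fin p) :
    column A (m + 1) j = A j m := by
  have hm : min ((m : ℕ) + 1 - 1) (M - 1) = m := by have := m.2; omega
  simp only [column]
  rw [dif_pos (hm.trans_lt m.2)]
  exact congrArg (A j) (Fin.ext hm)

theorem norm_column_succ_sq (A : Matrix (Fin p) (Fin M) ℝ) (m : Fin M) :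
    ‖column A (m + 1)‖ ^ 2 = ∑ j, A j m ^ 2 := by
  simp [EuclideanSpace.norm_sq_eq, column_succ_apply]

theorem column_zero (A : Matrix (Fin p) (Fin M) ℝ) : column A 0 = column A 1 := by
  simp [column]

theorem sum_norm_column_succ_sq (A : Matrix (Fin p) (Fin M) ℝ) :
    ∑ k ∈ Finset.range M, ‖column A (k + 1)‖ ^ 2 = frob A ^ 2 := by
  rw [frob_sq, Finset.sum_comm, ← Fin.sum_univ_eq_sum_range (fun k => ‖column A (k + 1)‖ ^ 2)]
  exact Finset.sum_congr rfl fun m _ => norm_column_succ_sq A m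

/-- The clamped index `0` repeats the first column, which may therefore be counted twice; hence the
factor `2`. -/
theorem sum_norm_column_sq_le (A : Matrix (Fin p) (Fin M) ℝ) :
    ∑ k ∈ Finset.range M, ‖column A k‖ ^ 2 ≤ 2 * frob A ^ 2 := by
  rcases M with _ | M
  · simp [sq_nonneg]
  · rw [Finset.sum_range_succ', column_zero, two_mul, ← sum_norm_column_succ_sq]
    refine add_le_add ?_ ?_
    · rw [Finset.sum_range_succ]
      exact le_add_of_nonneg_right (sq_nonneg _)
    · exact Finset.single_le_sum (f := fun k => ‖column A (k + 1)‖ ^ 2)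
        (fun _ _ => sq_nonneg _) (Finset.mem_range.2 M.succ_pos)

theorem column_discretize {β : ℝ → EuclideanSpace ℝ (Fin p)} {k : ℕ} (hk : k < M) :
    column (discretize β M) (k + 1) = β (((k + 1 : ℕ) : ℝ) / M) := by
  ext j
  rw [column_succ_apply (discretize β M) ⟨k, hk⟩ j]
  simp [discretize, gridPoint]

/-- Approximation error of the interpolation, on one grid interval. -/
theorem norm_interpolate_sub_le {β : ℝ → EuclideanSpace ℝ (Fin p)}
    (hβ : BoundedVariationOn β (Set.Icc 0 1)) (hM : 0 < M)
    (B : Matrix (Fin p) (Fin M) ℝ) {u : ℝ} (hu0 : 0 ≤ u) (hu1 : u < 1) :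
    ‖interpolate B u - β u‖ ≤ ‖column (B - discretize β M) ⌊u * M⌋₊‖
      + ‖column (B - discretize β M) (⌊u * M⌋₊ + 1)‖
      + (eVariationOn β (Set.Icc ((⌊u * M⌋₊ : ℝ) / M) (((⌊u * M⌋₊ + 1 : ℕ) : ℝ) / M))).toReal := by
  have hM' : (0 : ℝ) < M := by positivity
  set k := ⌊u * M⌋₊ with hk
  set θ := Int.fract (u * M) with hθ
  have huM : 0 ≤ u * M := by positivity
  have hkM : k < M := (Nat.floor_lt huM).2 (by nlinarith)
  have hku : (k : ℝ) / M ≤ u := by rw [div_le_iff₀ hM']; exact Nat.floor_le huM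
  have huk : u ≤ ((k + 1 : ℕ) : ℝ) / M := by
    rw [le_div_iff₀ hM']
    exact_mod_cast (Nat.lt_floor_add_one (u * M)).le
  set I := Set.Icc ((k : ℝ) / M) (((k + 1 : ℕ) : ℝ) / M) with hI
  have hsub : I ⊆ Set.Icc 0 1 := by
    refine Set.Icc_subset_Icc (by positivity) ?_
    rw [div_le_one hM']
    exact_mod_cast hkM
  have hBV : BoundedVariationOn β I := hβ.mono hsub
  set v := (eVariationOn β I).toReal with hv
  have hright : ‖column (discretize β M) (k + 1) - β u‖ ≤ v := by
    rw [column_discretize hkM, ← dist_eq_norm]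
    exact hBV.dist_le ⟨hku.trans huk, le_rfl⟩ ⟨hku, huk⟩
  have hleft : ‖column (discretize β M) k - β u‖ ≤ v := by
    -- On the first cell the interpolant is constant, so its left value is the right one.
    rcases Nat.eq_zero_or_pos k with h0 | hpos
    · rw [h0, column_zero]
      rw [h0] at hright
      exact hright
    · obtain ⟨l, hl⟩ := Nat.exists_eq_succ_of_ne_zero hpos.ne'
      have : column (discretize β M) k = β ((k : ℝ) / M) := by
        rw [hl]
        exact column_discretize (by omega)
      rw [this, ← dist_eq_norm]
      exact hBV.dist_le ⟨le_rfl, hku.trans huk⟩ ⟨hku, huk⟩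
  have hθ0 : 0 ≤ θ := Int.fract_nonneg _
  have hθ1 : θ ≤ 1 := (Int.fract_lt_one _).le
  have hdec : interpolate B u - β u
      = (1 - θ) • column (B - discretize β M) k + θ • column (B - discretize β M) (k + 1)
        + ((1 - θ) • (column (discretize β M) k - β u)
          + θ • (column (discretize β M) (k + 1) - β u)) := by
    rw [interpolate, column_sub, column_sub]
    module
  have hs : ∀ {t : ℝ} (w : EuclideanSpace ℝ (Fin p)), 0 ≤ t → ‖t • w‖ = t * ‖w‖ :=
    fun w ht => by rw [norm_smul, Real.norm_of_nonneg ht]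
  have h1θ : 0 ≤ 1 - θ := by linarith
  rw [hdec]
  refine (norm_add_le _ _).trans (add_le_add ((norm_add_le _ _).trans (add_le_add ?_ ?_)) ?_)
  · rw [hs _ h1θ]
    exact mul_le_of_le_one_left (norm_nonneg _) (by linarith)
  · rw [hs _ hθ0]
    exact mul_le_of_le_one_left (norm_nonneg _) hθ1
  · refine (norm_add_le _ _).trans ?_
    rw [hs _ h1θ, hs _ hθ0]
    nlinarith [mul_le_mul_of_nonneg_left hleft h1θ, mul_le_mul_of_nonneg_left hright hθ0]

/-- Stability and approximation error of the interpolation in `L²`. -/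
theorem l2Dist_interpolate_le {β : ℝ → EuclideanSpace ℝ (Fin p)}
    (hβ : BoundedVariationOn β (Set.Icc 0 1)) (hM : 0 < M) (B : Matrix (Fin p) (Fin M) ℝ) :
    l2Dist (interpolate B) β ≤ 3 * scaledDist B (discretize β M)
      + 2 * (eVariationOn β (Set.Icc 0 1)).toReal * (M : ℝ) ^ (-(1 / 2) : ℝ) := by
  have hM' : (0 : ℝ) < M := by positivity
  set A := B - discretize β M with hA
  set v : ℕ → ℝ := fun k =>
    (eVariationOn β (Set.Icc ((k : ℝ) / M) (((k + 1 : ℕ) : ℝ) / M))).toReal with hv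
  set V := (eVariationOn β (Set.Icc 0 1)).toReal with hV
  set g : ℕ → ℝ := fun k => 3 * (‖column A k‖ ^ 2 + ‖column A (k + 1)‖ ^ 2 + v k ^ 2) with hg
  have hv0 : ∀ k, 0 ≤ v k := fun k => ENNReal.toReal_nonneg
  have hV0 : 0 ≤ V := ENNReal.toReal_nonneg
  -- Variation is additive over the cells, so the squared cell variations sum to at most `V ^ 2`;
  -- averaging over `M` cells yields the order `M^{-1/2}`.
  have hvV : ∑ k ∈ Finset.range M, v k = V := by
    have hmono : Monotone fun k : ℕ => (k : ℝ) / M := fun a b hab => by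
      have : (a : ℝ) ≤ b := by exact_mod_cast hab
      exact div_le_div_of_nonneg_right this hM'.le
    have h := eVariationOn.sum' β hmono (n := M)
    simp only [Nat.cast_zero, zero_div, div_self hM'.ne'] at h
    rw [hV, ← h, ENNReal.toReal_sum]
    intro k hk
    refine ne_top_of_le_ne_top hβ (eVariationOn.mono β (Set.Icc_subset_Icc (by positivity) ?_))
    rw [div_le_one hM']
    exact_mod_cast Finset.mem_range.1 hk
  have hv2 : ∑ k ∈ Finset.range M, v k ^ 2 ≤ V ^ 2 := by
    rw [← hvV]
    exact Finset.sum_sq_le_sq_sum_of_nonneg fun k _ => hv0 k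
  have hint : ∫ u in (0 : ℝ)..1, ‖interpolate B u - β u‖ ^ 2 ≤ ∫ u in (0 : ℝ)..1, g ⌊u * M⌋₊ := by
    rw [intervalIntegral.integral_of_le zero_le_one, intervalIntegral.integral_of_le zero_le_one]
    refine integral_mono_of_nonneg (ae_of_all _ fun _ => sq_nonneg _)
      (intervalIntegrable_floor_comp hM g).1 ?_
    rw [EventuallyLE, ae_restrict_iff' measurableSet_Ioc]
    filter_upwards [compl_mem_ae_iff.2 (measure_singleton (1 : ℝ))] with u hu hmem
    have h := norm_interpolate_sub_le hβ hM B hmem.1.le (lt_of_le_of_ne hmem.2 hu)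
    rw [← hA] at h
    change _ ≤ _ + _ + v ⌊u * M⌋₊ at h
    refine (pow_le_pow_left₀ (norm_nonneg _) h 2).trans ?_
    simp only [hg]
    set a := ‖column A ⌊u * M⌋₊‖
    set b := ‖column A (⌊u * M⌋₊ + 1)‖
    set w := v ⌊u * M⌋₊
    linarith [sq_nonneg (a - b), sq_nonneg (a - w), sq_nonneg (b - w)]
  -- The constant `9` is `3 * (2 + 1)`: left columns count at most twice, right columns once.
  have hsum : ∑ k ∈ Finset.range M, g k ≤ 9 * frob A ^ 2 + 3 * V ^ 2 := by
    simp only [hg]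
    rw [← Finset.mul_sum, Finset.sum_add_distrib, Finset.sum_add_distrib,
      sum_norm_column_succ_sq]
    linarith [sum_norm_column_sq_le A]
  have hrpow : (M : ℝ) ^ (-(1 / 2) : ℝ) = (√(M : ℝ))⁻¹ := by
    rw [Real.rpow_neg hM'.le, Real.sqrt_eq_rpow]
  rw [l2Dist, hrpow]
  refine Real.sqrt_le_iff.2 ⟨?_, ?_⟩
  · have := frob_nonneg A
    rw [scaledDist, ← hA]
    positivity
  · refine hint.trans ?_
    rw [integral_floor_comp hM]
    refine (div_le_div_of_nonneg_right hsum hM'.le).trans ?_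
    rw [scaledDist, ← hA]
    have hsq : √(M : ℝ) ^ 2 = M := Real.sq_sqrt hM'.le
    have hf := frob_nonneg A
    have hs0 : 0 < √(M : ℝ) := by positivity
    have : (3 * (frob A / √(M : ℝ)) + 2 * V * (√(M : ℝ))⁻¹) ^ 2
        = (3 * frob A + 2 * V) ^ 2 / M := by
      rw [div_eq_mul_inv (_ ^ 2), ← hsq, ← inv_pow, hsq, ← mul_pow]
      ring
    rw [this]
    gcongr
    nlinarith [mul_nonneg hf hV0, sq_nonneg V]


theorem eq_zero_of_rank_eq_zero {k l : ℕ} {A : Matrix (Fin k) (Fin l) ℝ} (h : A.rank = 0) :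
    A = 0 := by
  rw [Matrix.rank, Submodule.finrank_eq_zero, LinearMap.range_eq_bot] at h
  ext i j
  have := congrFun (LinearMap.congr_fun h (Pi.single j 1)) i
  simpa using this

theorem exists_abs_le_of_isCompact {S : Set ℝ} (hS : IsCompact S) :
    ∃ K : ℝ, 0 < K ∧ ∀ s ∈ S, |s| ≤ K := by
  obtain ⟨K, hK0, hK⟩ := hS.isBounded.exists_pos_norm_le
  exact ⟨K, hK0, hK⟩

/-! ### Bounds and left-continuity of the coefficient function. -/

section Coefficient

variable {Ω : Type*} [MeasurableSpace Ω] {P : Measure Ω} {p : ℕ} {S : Set ℝ}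
  {𝓕 : Set (Measure ℝ)} {X : Ω → EuclideanSpace ℝ (Fin p)} {Y : Ω → Measure ℝ}
  {F : EuclideanSpace ℝ (Fin p) → Measure ℝ} {α : ℝ → ℝ} {β : ℝ → EuclideanSpace ℝ (Fin p)}

theorem single_mem_unitCube (j : Fin p) :
    (EuclideanSpace.single j 1 : EuclideanSpace ℝ (Fin p)) ∈ unitCube p := by
  intro i
  by_cases h : i = j <;> simp [h]

theorem zero_mem_unitCube : (0 : EuclideanSpace ℝ (Fin p)) ∈ unitCube p := by
  intro i
  simp

/-- Evaluating the linear model at a unit vector and at the origin isolates one coefficient. As a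
difference of two quantile functions it is bounded and left-continuous. -/
theorem IsFrechetModel.coef_eq (h : IsFrechetModel P S 𝓕 X Y F α β) {u : ℝ}
    (hu : u ∈ Set.Icc (0 : ℝ) 1) (j : Fin p) :
    β u j = quantile S (F (EuclideanSpace.single j 1)) u - quantile S (F 0) u := by
  rw [h.linear _ (single_mem_unitCube j) u hu, h.linear _ zero_mem_unitCube u hu,
    add_sub_add_left_eq_sub, ← Finset.sum_sub_distrib]
  simp only [← mul_sub, sub_sub_sub_cancel_right]
  simp

theorem IsFrechetModel.abs_coef_le (h : IsFrechetModel P S 𝓕 X Y F α β) {K : ℝ}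
    (hK : ∀ s ∈ S, |s| ≤ K) {u : ℝ} (hu : u ∈ Set.Icc (0 : ℝ) 1) (j : Fin p) :
    |β u j| ≤ 2 * K := by
  have h1 := h.family _ (h.F_mem _ (single_mem_unitCube j))
  have h2 := h.family _ (h.F_mem _ zero_mem_unitCube)
  have := h1.1
  have := h2.1
  rw [h.coef_eq hu j]
  refine (abs_sub _ _).trans ?_
  linarith [abs_quantile_le h.isCompact h1.2 hu.2 hK, abs_quantile_le h.isCompact h2.2 hu.2 hK]

theorem IsFrechetModel.tendsto_coef_left (h : IsFrechetModel P S 𝓕 X Y F α β) {u : ℝ}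
    (hu : u ∈ Set.Ioc (0 : ℝ) 1) (j : Fin p) :
    Tendsto (fun v => β v j) (𝓝[≤] u) (𝓝 (β u j)) := by
  have h1 := h.family _ (h.F_mem _ (single_mem_unitCube j))
  have h2 := h.family _ (h.F_mem _ zero_mem_unitCube)
  have := h1.1
  have := h2.1
  rw [h.coef_eq ⟨hu.1.le, hu.2⟩ j]
  refine ((tendsto_quantile_left h.isCompact h1.2 hu.1 hu.2).sub
    (tendsto_quantile_left h.isCompact h2.2 hu.1 hu.2)).congr' ?_
  filter_upwards [self_mem_nhdsWithin, mem_nhdsWithin_of_mem_nhds (Ioi_mem_nhds hu.1)] with v hv hv0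
  exact (h.coef_eq ⟨le_of_lt hv0, le_trans hv hu.2⟩ j).symm

end Coefficient

/-! ### Uniform bounds for the true matrix and its penalty. -/

section GridNorm

variable {p : ℕ} {β : ℝ → EuclideanSpace ℝ (Fin p)}

theorem gridPoint_mem {M : ℕ} (m : Fin M) : gridPoint M m ∈ Set.Ioc (0 : ℝ) 1 := by
  have hM : (0 : ℝ) < M := by exact_mod_cast m.pos
  refine ⟨by unfold gridPoint; positivity, ?_⟩
  rw [gridPoint, div_le_one hM]
  exact_mod_cast m.2

/-- A minimum over finitely many grids; this handles the coarse grids that can miss the interval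
where `β` is known to be large. -/
theorem exists_le_frob_discretize_of_lt (β : ℝ → EuclideanSpace ℝ (Fin p)) (N : ℕ) :
    ∃ η > 0, ∀ M < N, discretize β M ≠ 0 → η ≤ frob (discretize β M) / √(M : ℝ) := by
  induction N with
  | zero => exact ⟨1, one_pos, fun M hM => absurd hM (Nat.not_lt_zero M)⟩
  | succ N ih =>
    obtain ⟨η, hη, h⟩ := ih
    by_cases h0 : discretize β N = 0
    · refine ⟨η, hη, fun M hM hne => h M ?_ hne⟩
      rcases Nat.lt_succ_iff_lt_or_eq.1 hM with hlt | rfl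
      · exact hlt
      · exact absurd h0 hne
    · have hN : 0 < N := by
        rcases Nat.eq_zero_or_pos N with rfl | hN
        · exact absurd (Subsingleton.elim _ _) h0
        · exact hN
      have hpos : 0 < frob (discretize β N) / √(N : ℝ) := by
        have := frob_pos h0
        positivity
      refine ⟨min η (frob (discretize β N) / √(N : ℝ)), lt_min hη hpos, fun M hM hne => ?_⟩
      rcases Nat.lt_succ_iff_lt_or_eq.1 hM with hlt | rfl
      · exact (min_le_left _ _).trans (h M hlt hne)
      · exact min_le_right _ _

/-- If a left-continuous function does not vanish on a grid, then its norm on the grid is bounded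
below, uniformly over the grids. -/
theorem exists_le_frob_discretize
    (hβ : ∀ u ∈ Set.Ioc (0 : ℝ) 1, ∀ j, Tendsto (fun v => β v j) (𝓝[≤] u) (𝓝 (β u j))) :
    ∃ η > 0, ∀ M, discretize β M ≠ 0 → η ≤ frob (discretize β M) / √(M : ℝ) := by
  by_cases hex : ∃ u ∈ Set.Ioc (0 : ℝ) 1, ∃ j, β u j ≠ 0
  swap
  · refine ⟨1, one_pos, fun M hne => absurd ?_ hne⟩
    push Not at hex
    ext j m
    simp [discretize, hex _ (gridPoint_mem m) j]
  obtain ⟨u, hu, j, hj⟩ := hex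
  set a := |β u j| / 2 with ha
  have ha0 : 0 < a := by positivity
  have hev : ∀ᶠ v in 𝓝[≤] u, a < |β v j| :=
    (hβ u hu j).abs.eventually (lt_mem_nhds (by rw [ha]; linarith [abs_pos.2 hj]))
  obtain ⟨l, hlu, hl⟩ := (mem_nhdsLE_iff_exists_mem_Ico_Ioc_subset hu.1).1 hev
  set η := u - l with hη
  have hη0 : 0 < η := sub_pos.2 hlu.2
  -- For `M ≥ N` the interval `(l, u]` contains at least `η * M - 1 ≥ η * M / 2` grid points, each
  -- contributing at least `a ^ 2`.
  obtain ⟨N, hN⟩ := exists_nat_ge (2 / η)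
  obtain ⟨ε, hε, hsmall⟩ := exists_le_frob_discretize_of_lt β N
  refine ⟨min ε (a * √(η / 2)), lt_min hε (by positivity), fun M hne => ?_⟩
  rcases lt_or_ge M N with hMN | hMN
  · exact (min_le_left _ _).trans (hsmall M hMN hne)
  refine (min_le_right _ _).trans ?_
  have hMη : 2 ≤ η * M := by
    have h1 : 2 / η ≤ M := hN.trans (by exact_mod_cast hMN)
    rw [div_le_iff₀ hη0] at h1
    linarith
  have hM' : (0 : ℝ) < M := by
    by_contra hcon
    have : η * M ≤ 0 := mul_nonpos_of_nonneg_of_nonpos hη0.le (not_lt.1 hcon)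
    linarith
  set k₁ := ⌊l * M⌋₊ with hk₁
  set k₂ := ⌊u * M⌋₊ with hk₂
  have hk₂M : k₂ ≤ M := by
    refine Nat.floor_le_of_le ?_
    nlinarith [hu.2]
  have hlow : ∀ k ∈ Finset.Ico k₁ k₂, a ^ 2 ≤ ‖column (discretize β M) (k + 1)‖ ^ 2 := by
    intro k hk
    obtain ⟨hk1, hk2⟩ := Finset.mem_Ico.1 hk
    have h1 : l * M < (k + 1 : ℕ) := by
      refine (Nat.lt_floor_add_one _).trans_le ?_
      push_cast
      have : (k₁ : ℝ) ≤ k := by exact_mod_cast hk1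
      linarith
    have h2 : ((k + 1 : ℕ) : ℝ) ≤ u * M := by
      refine le_trans ?_ (Nat.floor_le (mul_nonneg hu.1.le hM'.le))
      exact_mod_cast hk2
    have hmem : ((k + 1 : ℕ) : ℝ) / M ∈ Set.Ioc l u :=
      ⟨by rwa [lt_div_iff₀ hM'], by rwa [div_le_iff₀ hM']⟩
    have h3 : a < |β (((k + 1 : ℕ) : ℝ) / M) j| := hl hmem
    rw [column_discretize (by omega), EuclideanSpace.norm_sq_eq]
    refine le_trans ?_ (Finset.single_le_sum (f := fun i => ‖β (((k + 1 : ℕ) : ℝ) / M) i‖ ^ 2)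
      (fun _ _ => sq_nonneg _) (Finset.mem_univ j))
    exact pow_le_pow_left₀ ha0.le h3.le 2
  have hcard : η * M / 2 ≤ (k₂ - k₁ : ℕ) := by
    have h1 : (k₁ : ℝ) ≤ l * M := Nat.floor_le (mul_nonneg hlu.1 hM'.le)
    have h2 : u * M < k₂ + 1 := Nat.lt_floor_add_one _
    have h3 : (k₂ : ℝ) ≤ ((k₂ - k₁ : ℕ) : ℝ) + k₁ := by exact_mod_cast (le_tsub_add : k₂ ≤ k₂ - k₁ + k₁)
    have h4 : η * M = u * M - l * M := by rw [hη]; ring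
    linarith
  have hfrob : (a * √(η / 2)) ^ 2 * M ≤ frob (discretize β M) ^ 2 := by
    rw [← sum_norm_column_succ_sq]
    calc (a * √(η / 2)) ^ 2 * M = (η * M / 2) * a ^ 2 := by
          rw [mul_pow, Real.sq_sqrt (by positivity)]
          ring
      _ ≤ (k₂ - k₁ : ℕ) * a ^ 2 := by gcongr
      _ = ∑ _k ∈ Finset.Ico k₁ k₂, a ^ 2 := by simp
      _ ≤ ∑ k ∈ Finset.Ico k₁ k₂, ‖column (discretize β M) (k + 1)‖ ^ 2 := Finset.sum_le_sum hlow
      _ ≤ _ := Finset.sum_le_sum_of_subset_of_nonneg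
          (fun k hk => Finset.mem_range.2 ((Finset.mem_Ico.1 hk).2.trans_le hk₂M))
          fun _ _ _ => sq_nonneg _
  rw [le_div_iff₀ (by positivity)]
  refine abs_le_of_sq_le_sq' ?_ (frob_nonneg _) |>.2
  rwa [mul_pow, Real.sq_sqrt hM'.le]

theorem frob_discretize_le {K : ℝ} (hK : 0 ≤ K)
    (hβ : ∀ u ∈ Set.Icc (0 : ℝ) 1, ∀ j, |β u j| ≤ K) (M : ℕ) :
    frob (discretize β M) ≤ K * √(p : ℝ) * √(M : ℝ) := by
  refine abs_le_of_sq_le_sq' ?_ (by positivity) |>.2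
  rw [frob_sq, mul_pow, mul_pow, Real.sq_sqrt (Nat.cast_nonneg p), Real.sq_sqrt (Nat.cast_nonneg M)]
  calc ∑ j, ∑ m, discretize β M j m ^ 2 ≤ ∑ _j : Fin p, ∑ _m : Fin M, K ^ 2 := by
        refine Finset.sum_le_sum fun j _ => Finset.sum_le_sum fun m _ => ?_
        have := hβ _ (Set.Ioc_subset_Icc_self (gridPoint_mem m)) j
        exact sq_le_sq.2 (this.trans (le_abs_self K))
    _ = K ^ 2 * p * M := by simp; ring

/-- The penalty of the true matrix is bounded, uniformly over the grids. -/
theorem exists_penalty_le {K η : ℝ} (hK : 0 < K)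
    (hβ : ∀ u ∈ Set.Icc (0 : ℝ) 1, ∀ j, |β u j| ≤ K) (hη : 0 < η)
    (hlow : ∀ M, discretize β M ≠ 0 → η ≤ frob (discretize β M) / √(M : ℝ))
    {r : ℕ} {M : ℕ → ℕ} (hM : ∀ n, 0 < M n) (hr : 0 < r)
    (hrank : ∀ n, discretize β (M n) ∈ rankSet p (M n) r)
    {J : (m : ℕ) → Matrix (Fin p) (Fin m) ℝ → ℝ} (hJ : IsPenalty J)
    (hpen : PenaltyCondition β r M J) :
    ∃ C > 0, ∀ n, J (M n) (discretize β (M n)) ≤ C := by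
  set ρ := K * √(p : ℝ) + 1 with hρ
  have hρ0 : 0 < ρ := by positivity
  -- The comparison matrix is `t • B` with `0 < t < 1 / 2`, at a distance strictly between `η / 2`
  -- and `ρ`. The scalar `t` may depend on `n`, but `C` does not.
  obtain ⟨C, hC, h⟩ := hpen (η / 2) (half_pos hη) ρ hρ0
  refine ⟨1 + C * ρ, by positivity, fun n => ?_⟩
  set B := discretize β (M n) with hB
  have hM' : (0 : ℝ) < M n := by exact_mod_cast hM n
  have hB0 : B ≠ 0 := by
    intro h0
    have h1 : B.rank = r := hrank n
    rw [h0, Matrix.rank_zero] at h1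
    omega
  have hcont : Tendsto (fun t : ℝ => J (M n) (t • B)) (𝓝[>] 0) (𝓝 0) := by
    have h1 : Tendsto (fun t : ℝ => t • B) (𝓝 0) (𝓝 0) := by
      have : Continuous fun t : ℝ => t • B := by fun_prop
      simpa using this.tendsto 0
    have h2 := (hJ.continuousAt (M n)).tendsto.comp h1
    rw [hJ.zero] at h2
    exact h2.mono_left nhdsWithin_le_nhds
  obtain ⟨t, ht1, ht0, ht2⟩ := ((hcont.eventually (gt_mem_nhds one_pos)).and
    (Ioo_mem_nhdsGT (show (0 : ℝ) < 1 / 2 by norm_num))).exists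
  have hd : scaledDist (t • B) B = (1 - t) * (frob B / √(M n : ℝ)) := by
    have h1 : t • B - B = (t - 1) • B := by rw [sub_smul, one_smul]
    rw [scaledDist, h1, frob_smul, abs_sub_comm, abs_of_pos (by linarith), mul_div_assoc]
  have hq1 := hlow _ hB0
  have hq2 : frob B / √(M n : ℝ) ≤ K * √(p : ℝ) := by
    rw [div_le_iff₀ (by positivity)]
    exact frob_discretize_le hK.le hβ _
  have hdρ : scaledDist (t • B) B ≤ ρ := by
    rw [hd, hρ]
    nlinarith
  have hrk : t • B ∈ rankSet p (M n) r := by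
    have h1 : B.rank = r := hrank n
    change (t • B).rank = r
    rw [Matrix.rank_smul_of_mem_nonZeroDivisors B (mem_nonZeroDivisors_of_ne_zero ht0.ne'), h1]
  have := h n (t • B) hrk hdρ (by rw [hd]; nlinarith)
  have h3 : C * scaledDist (t • B) B ≤ C * ρ := by gcongr
  linarith [(abs_le.1 this).1]

end GridNorm


/-! ### Second moments of independent sums. -/

section Sums

variable {Ω E : Type*} [MeasurableSpace Ω] [MeasurableSpace E] {P : Measure Ω}
  [IsProbabilityMeasure P]

/-- Second moment of a sum of independent, identically distributed, centered bounded variables. -/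
theorem integral_sq_sum_le {Z : ℕ → Ω → E} {Z₀ : Ω → E} (hindep : iIndepFun Z P)
    (hident : ∀ i, IdentDistrib (Z i) Z₀ P P) {g : E → ℝ} (hg : Measurable g) {C : ℝ}
    (hbound : ∀ᵐ ω ∂P, |g (Z₀ ω)| ≤ C) (hmean : ∫ ω, g (Z₀ ω) ∂P = 0) (n : ℕ) :
    Integrable (fun ω => (∑ i ∈ Finset.range n, g (Z i ω)) ^ 2) P ∧
      ∫ ω, (∑ i ∈ Finset.range n, g (Z i ω)) ^ 2 ∂P ≤ n * C ^ 2 := by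
  have hid : ∀ i, IdentDistrib (fun ω => g (Z i ω)) (fun ω => g (Z₀ ω)) P P :=
    fun i => (hident i).comp hg
  have hL : ∀ i, MemLp (fun ω => g (Z i ω)) 2 P := fun i =>
    (hid i).memLp_iff.2 (MemLp.of_bound (hid i).aemeasurable_snd.aestronglyMeasurable C hbound)
  have hC : ∀ i, ∀ᵐ ω ∂P, g (Z i ω) ^ 2 ≤ C ^ 2 := fun i => by
    filter_upwards [(hid i).symm.ae_snd (p := fun t => |t| ≤ C)
      (measurableSet_le measurable_norm measurable_const) hbound] with ω hω
    exact sq_le_sq.2 (hω.trans (le_abs_self C))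
  have hsum : MemLp (∑ i ∈ Finset.range n, fun ω => g (Z i ω)) 2 P :=
    memLp_finsetSum' _ fun i _ => hL i
  have hfun : (fun ω => (∑ i ∈ Finset.range n, g (Z i ω)) ^ 2)
      = fun ω => (∑ i ∈ Finset.range n, fun ω => g (Z i ω)) ω ^ 2 := by
    ext ω
    simp
  have hm0 : ∀ i, ∫ ω, g (Z i ω) ∂P = 0 := fun i => (hid i).integral_eq.trans hmean
  refine ⟨by rw [hfun]; exact hsum.integrable_sq, ?_⟩
  have hzero : P[∑ i ∈ Finset.range n, fun ω => g (Z i ω)] = 0 := by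
    simp only [Finset.sum_apply]
    rw [integral_finsetSum _ fun i _ => (hL i).integrable one_le_two]
    exact Finset.sum_eq_zero fun i _ => hm0 i
  rw [hfun, ← variance_of_integral_eq_zero hsum.aestronglyMeasurable.aemeasurable hzero,
    IndepFun.variance_sum (fun i _ => hL i)
      fun i _ j _ hij => (hindep.indepFun hij).comp hg hg]
  calc ∑ i ∈ Finset.range n, Var[fun ω => g (Z i ω); P]
      ≤ ∑ _i ∈ Finset.range n, C ^ 2 := by
        refine Finset.sum_le_sum fun i _ => ?_
        rw [variance_of_integral_eq_zero (hL i).aestronglyMeasurable.aemeasurable (hm0 i)]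
        refine (integral_mono_ae (hL i).integrable_sq (integrable_const _) (hC i)).trans ?_
        simp
    _ = n * C ^ 2 := by simp

end Sums

/-! ### Errors on the grid and their product with the design. -/

section Noise

variable {Ω : Type*} [MeasurableSpace Ω] {P : Measure Ω} [IsProbabilityMeasure P] {p : ℕ}
  {S : Set ℝ} {𝓕 : Set (Measure ℝ)} {X : Ω → EuclideanSpace ℝ (Fin p)} {Y : Ω → Measure ℝ}
  {F : EuclideanSpace ℝ (Fin p) → Measure ℝ} {α : ℝ → ℝ} {β : ℝ → EuclideanSpace ℝ (Fin p)}

theorem measurable_coord (j : Fin p) : Measurable fun x : EuclideanSpace ℝ (Fin p) => x j := by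
  fun_prop

theorem measurableSet_unitCube : MeasurableSet (unitCube p) := by
  have : unitCube p = ⋂ j, (fun x : EuclideanSpace ℝ (Fin p) => x j) ⁻¹' Set.Icc 0 1 := by
    ext x
    simp [unitCube]
  rw [this]
  exact MeasurableSet.iInter fun j => measurable_coord j measurableSet_Icc

/-- A measurable version of the pseudo-error as a function of covariate and response. -/
theorem IsFrechetModel.exists_error (h : IsFrechetModel P S 𝓕 X Y F α β) {K : ℝ}
    (hK : ∀ s ∈ S, |s| ≤ K) {u : ℝ} (hu : u ∈ Set.Ioc (0 : ℝ) 1) :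
    ∃ g : EuclideanSpace ℝ (Fin p) × Measure ℝ → ℝ, Measurable g ∧
      (∀ x, ∀ y ∈ 𝓕, g (x, y)
        = quantile S y u - (α u + ∑ j, β u j * (x j - meanVec P X j))) ∧
      (∀ᵐ ω ∂P, |g (X ω, Y ω)| ≤ 2 * K) ∧ ∫ ω, g (X ω, Y ω) ∂P = 0 ∧
      ∀ j, ∫ ω, X ω j * g (X ω, Y ω) ∂P = 0 := by
  obtain ⟨q, hq, hqe⟩ := exists_measurable_quantile h.isCompact h.family hu.1 hu.2
  have hmX := h.measurable_X
  have hmq : Measurable fun ω => q (Y ω) := hq.comp h.measurable_Y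
  set L : EuclideanSpace ℝ (Fin p) → ℝ := fun x =>
    α u + ∑ j, β u j * (x j - meanVec P X j) with hL
  have hLm : Measurable L := by
    refine measurable_const.add (Finset.measurable_sum _ fun j _ => ?_)
    exact ((measurable_coord j).sub_const _).const_mul _
  have hqK : ∀ ω, |q (Y ω)| ≤ K := fun ω => by
    have hf := h.family _ (h.Y_mem ω)
    have := hf.1
    rw [hqe _ (h.Y_mem ω)]
    exact abs_quantile_le h.isCompact hf.2 hu.2 hK
  have hLF : ∀ᵐ ω ∂P, quantile S (F (X ω)) u = L (X ω) := by
    filter_upwards [h.X_mem] with ω hω using h.linear _ hω u ⟨hu.1.le, hu.2⟩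
  have hLK : ∀ᵐ ω ∂P, |L (X ω)| ≤ K := by
    filter_upwards [h.X_mem, hLF] with ω hω hω'
    have hf := h.family _ (h.F_mem _ hω)
    have := hf.1
    rw [← hω']
    exact abs_quantile_le h.isCompact hf.2 hu.2 hK
  have hqfun : (fun ω => quantile S (Y ω) u) = fun ω => q (Y ω) := by
    ext ω
    rw [hqe _ (h.Y_mem ω)]
  have hcond : P[fun ω => q (Y ω) | sigmaX X] =ᵐ[P] fun ω => L (X ω) := by
    rw [← hqfun]
    exact (h.condMean u ⟨hu.1.le, hu.2⟩).trans hLF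
  have hiq : Integrable (fun ω => q (Y ω)) P :=
    Integrable.of_bound hmq.aestronglyMeasurable K (ae_of_all _ hqK)
  have hiL : Integrable (fun ω => L (X ω)) P :=
    Integrable.of_bound (hLm.comp hmX).aestronglyMeasurable K hLK
  have hle : sigmaX X ≤ ‹MeasurableSpace Ω› := hmX.comap_le
  -- The error is orthogonal to bounded functions of `X`, by pulling them out of the conditional
  -- expectation. The constant `1` and the coordinates are the cases used.
  have horth : ∀ f : EuclideanSpace ℝ (Fin p) → ℝ, Measurable f → (∀ᵐ ω ∂P, |f (X ω)| ≤ 1) →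
      ∫ ω, f (X ω) * (q (Y ω) - L (X ω)) ∂P = 0 := by
    intro f hf hf1
    have hfm : AEStronglyMeasurable (fun ω => f (X ω)) P := (hf.comp hmX).aestronglyMeasurable
    have hifq : Integrable ((fun ω => f (X ω)) * fun ω => q (Y ω)) P :=
      hiq.bdd_mul hfm hf1
    have hifL : Integrable ((fun ω => f (X ω)) * fun ω => L (X ω)) P :=
      hiL.bdd_mul hfm hf1
    have hsm : StronglyMeasurable[sigmaX X] fun ω => f (X ω) :=
      (hf.comp (comap_measurable X)).stronglyMeasurable
    have hpull := condExp_mul_of_stronglyMeasurable_left hsm hifq hiq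
    have heq : ∫ ω, ((fun ω => f (X ω)) * fun ω => q (Y ω)) ω ∂P
        = ∫ ω, ((fun ω => f (X ω)) * fun ω => L (X ω)) ω ∂P := by
      rw [← integral_condExp hle]
      refine integral_congr_ae (hpull.trans ?_)
      filter_upwards [hcond] with ω hω
      simp only [Pi.mul_apply, hω]
    have hsub := integral_sub hifq hifL
    rw [heq, sub_self] at hsub
    simpa only [mul_sub, Pi.mul_apply] using hsub
  refine ⟨fun z => q z.2 - L z.1, (hq.comp measurable_snd).sub (hLm.comp measurable_fst),
    fun x y hy => congrArg (· - L x) (hqe y hy), ?_, ?_, fun j => ?_⟩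
  · filter_upwards [hLK] with ω hω
    exact (abs_sub _ _).trans (by linarith [hqK ω])
  · simpa using horth (fun _ => 1) measurable_const (ae_of_all _ fun _ => by simp)
  · refine horth (fun x => x j) (measurable_coord j) ?_
    filter_upwards [h.X_mem] with ω hω
    rw [abs_of_nonneg (hω j).1]
    exact (hω j).2

/-- The errors `Q_{Yᵢ}(u_m) - Q(u_m | Xᵢ)` on the grid. -/
noncomputable def gridError (P : Measure Ω) (S : Set ℝ) (X : Ω → EuclideanSpace ℝ (Fin p)) (α : ℝ → ℝ)
    (β : ℝ → EuclideanSpace ℝ (Fin p)) (x : ℕ → EuclideanSpace ℝ (Fin p)) (y : ℕ → Measure ℝ)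
    (M : ℕ) (i : ℕ) (m : Fin M) : ℝ :=
  quantile S (y i) (gridPoint M m)
    - (α (gridPoint M m) + ∑ j, β (gridPoint M m) j * (x i j - meanVec P X j))

variable {Xs : ℕ → Ω → EuclideanSpace ℝ (Fin p)} {Ys : ℕ → Ω → Measure ℝ}

omit [IsProbabilityMeasure P] in
theorem IsFrechetModel.ae_sample_mem (h : IsFrechetModel P S 𝓕 X Y F α β)
    (hs : IsRandomSample P 𝓕 X Y Xs Ys) : ∀ᵐ ω ∂P, ∀ i, Xs i ω ∈ unitCube p := by
  rw [ae_all_iff]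
  intro i
  exact (hs.identDistrib i).symm.ae_snd (p := fun z => z.1 ∈ unitCube p)
    (measurable_fst measurableSet_unitCube) h.X_mem

/-- The product of the centered design and the errors has Frobenius norm of order `√(M n)`. -/
theorem IsFrechetModel.exists_design_noise_bound (h : IsFrechetModel P S 𝓕 X Y F α β)
    (hs : IsRandomSample P 𝓕 X Y Xs Ys) :
    ∃ C > 0, ∀ n M : ℕ, 0 < n → 0 < M → ∀ K > 0,
      P {ω | K * (M * n) < frob ((centeredDesign (fun i => Xs i ω) n).transpose *
        Matrix.of fun (i : Fin n) m => gridError P S X α β (fun i => Xs i ω) (fun i => Ys i ω)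
          M i m) ^ 2} ≤ ENNReal.ofReal (C / K) := by
  obtain ⟨b, hb, hbS⟩ := exists_abs_le_of_isCompact h.isCompact
  -- Each of the `p * M` entries has two second moments of at most `n * (2 * b) ^ 2`, both weighted
  -- by `2`; the added `1` keeps the constant positive when `p = 0`.
  refine ⟨p * (4 * (2 * b) ^ 2) + 1, by positivity, fun n M hn hM K hK => ?_⟩
  have hg := fun m : Fin M => h.exists_error hbS (gridPoint_mem m)
  choose g hgm hge hgb hg0 hgX using hg
  have hX1 : ∀ j, ∀ᵐ ω ∂P, |X ω j| ≤ 1 := fun j => by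
    filter_upwards [h.X_mem] with ω hω
    rw [abs_of_nonneg (hω j).1]
    exact (hω j).2
  have hA := fun m : Fin M => integral_sq_sum_le hs.indep hs.identDistrib (hgm m) (hgb m) (hg0 m) n
  have hB := fun (j : Fin p) (m : Fin M) => integral_sq_sum_le hs.indep hs.identDistrib
    (g := fun z => z.1 j * g m z) (((measurable_coord j).comp measurable_fst).mul (hgm m))
    (C := 2 * b) (by
      filter_upwards [hgb m, hX1 j] with ω h1 h2
      rw [abs_mul]
      exact (mul_le_of_le_one_left (abs_nonneg _) h2).trans h1) (hgX m j) n
  set H : Ω → ℝ := fun ω => ∑ j : Fin p, ∑ m : Fin M,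
    (2 * (∑ i ∈ Finset.range n, Xs i ω j * g m (Xs i ω, Ys i ω)) ^ 2
      + 2 * (∑ i ∈ Finset.range n, g m (Xs i ω, Ys i ω)) ^ 2) with hH
  have hint : ∀ (j : Fin p) (m : Fin M), Integrable (fun ω =>
      2 * (∑ i ∈ Finset.range n, Xs i ω j * g m (Xs i ω, Ys i ω)) ^ 2
      + 2 * (∑ i ∈ Finset.range n, g m (Xs i ω, Ys i ω)) ^ 2) P := fun j m =>
    ((hB j m).1.const_mul 2).add ((hA m).1.const_mul 2)
  have hHint : Integrable H P :=
    integrable_finsetSum _ fun j _ => integrable_finsetSum _ fun m _ => hint j m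
  have hEH : ∫ ω, H ω ∂P ≤ p * (4 * (2 * b) ^ 2) * (M * n) := by
    simp only [hH]
    rw [integral_finsetSum _ fun j _ => integrable_finsetSum _ fun m _ => hint j m]
    calc _ ≤ ∑ _j : Fin p, ∑ _m : Fin M, 4 * (n * (2 * b) ^ 2) := by
          refine Finset.sum_le_sum fun j _ => ?_
          rw [integral_finsetSum _ fun m _ => hint j m]
          refine Finset.sum_le_sum fun m _ => ?_
          rw [integral_add ((hB j m).1.const_mul 2) ((hA m).1.const_mul 2),
            integral_const_mul, integral_const_mul]
          linarith [(hB j m).2, (hA m).2]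
      _ = _ := by simp; ring
  have hHnn : ∀ ω, 0 ≤ H ω := fun ω =>
    Finset.sum_nonneg fun _ _ => Finset.sum_nonneg fun _ _ => by positivity
  have hmarkov := mul_meas_ge_le_integral_of_nonneg (ae_of_all P hHnn) hHint (K * (M * n))
  have hpos : (0 : ℝ) < M * n := by positivity
  have hprob : P.real {ω | K * (M * n) ≤ H ω} ≤ (p * (4 * (2 * b) ^ 2) + 1) / K := by
    rw [le_div_iff₀ hK]
    refine le_of_mul_le_mul_right ?_ hpos
    linarith
  refine le_trans ?_ (ENNReal.le_ofReal_iff_toReal_le (measure_ne_top P _) (by positivity) |>.2 hprob)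
  refine measure_mono_ae ?_
  filter_upwards [h.ae_sample_mem hs] with ω hω
  intro hlt
  refine le_of_lt (lt_of_lt_of_le hlt ((frob_design_noise_sq_le hω _ n).trans_eq ?_))
  simp only [hH, gridError]
  refine Finset.sum_congr rfl fun j _ => Finset.sum_congr rfl fun m _ => ?_
  simp only [hge m _ _ (hs.mem _ ω)]

end Noise


/-! ### From the basic inequality to the stochastic rate. -/

/-- For larger `x` one has `c ^ 2 * x > 2 * a + b * c` and `c * x > b`; multiplying the first by `x`
contradicts the quadratic inequality. -/
theorem le_add_of_sq_le {a b c x : ℝ} (ha : 0 ≤ a) (hb : 0 ≤ b) (hc : 0 < c)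
    (h : c ^ 2 * x ^ 2 ≤ 2 * (x * a) + b ^ 2) : x ≤ 2 * a / c ^ 2 + b / c := by
  by_contra hcon
  have h1 : 2 * a / c ^ 2 < x - b / c := by linarith
  have h2 : b / c < x := by
    have : 0 ≤ 2 * a / c ^ 2 := by positivity
    linarith
  have hx : 0 < x := (div_nonneg hb hc.le).trans_lt h2
  rw [div_lt_iff₀ (by positivity)] at h1
  have h3 : b < x * c := by rwa [div_lt_iff₀ hc] at h2
  have h4 : (x - b / c) * c ^ 2 = x * c ^ 2 - b * c := by field_simp
  rw [h4] at h1
  nlinarith [mul_lt_mul_of_pos_left h1 hx, mul_nonneg hb (sub_nonneg.2 h3.le)]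

/-- Deterministic error bound for the estimator. -/
theorem scaledDist_le_of_isSolution {p n M r : ℕ} {S : Set ℝ} {x : ℕ → EuclideanSpace ℝ (Fin p)}
    {y : ℕ → Measure ℝ} {lam : ℝ} {J : Matrix (Fin p) (Fin M) ℝ → ℝ}
    {B B₀ : Matrix (Fin p) (Fin M) ℝ} (hB : IsSolution S x y n M r lam J B)
    (hB₀ : B₀ ∈ rankSet p M r) (hn : 0 < n) (hM : 0 < M) (hlam : 0 ≤ lam) (hJ : 0 ≤ J B)
    {C₀ : ℝ} (hC₀ : 0 ≤ C₀) (hJ₀ : J B₀ ≤ C₀) (a : Fin M → ℝ) (e : ℕ → Fin M → ℝ)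
    (hy : ∀ i m, quantile S (y i) (gridPoint M m) = a m + ∑ j, B₀ j m * x i j + e i m)
    {c K : ℝ} (hc : 0 < c) (hK : 0 ≤ K)
    (hconv : c ^ 2 * frob (B - B₀) ^ 2
      ≤ (n : ℝ)⁻¹ * frob (centeredDesign x n * (B - B₀)) ^ 2)
    (hnoise : frob ((centeredDesign x n).transpose * Matrix.of fun (i : Fin n) m => e i m) ^ 2
      ≤ K * (M * n)) :
    scaledDist B B₀ ≤ 2 * √K / c ^ 2 * √(1 / (n : ℝ)) + √C₀ / c * √(lam / n) := by
  have hn' : (0 : ℝ) < n := by positivity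
  have hM' : (0 : ℝ) < M := by positivity
  have hbasic := hB.basic_inequality hB₀ hM hlam hJ a e hy
  set f := frob (B - B₀) with hf
  set Z := frob ((centeredDesign x n).transpose * Matrix.of fun (i : Fin n) m => e i m) with hZ
  have hf0 : 0 ≤ f := frob_nonneg _
  have hZle : Z ≤ √K * √(M : ℝ) * √(n : ℝ) := by
    refine abs_le_of_sq_le_sq' ?_ (by positivity) |>.2
    rw [mul_pow, mul_pow, Real.sq_sqrt hK, Real.sq_sqrt hM'.le, Real.sq_sqrt hn'.le]
    linarith
  have hd : f = scaledDist B B₀ * √(M : ℝ) := by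
    rw [scaledDist, div_mul_cancel₀ _ (by positivity)]
  have hd0 : 0 ≤ scaledDist B B₀ := by
    rw [scaledDist]
    exact div_nonneg (frob_nonneg _) (Real.sqrt_nonneg _)
  set d := scaledDist B B₀ with hdd
  have hmain : c ^ 2 * f ^ 2 * n ≤ 2 * (f * (√K * √(M : ℝ) * √(n : ℝ))) + M * (lam * C₀) := by
    have h1 : c ^ 2 * f ^ 2 * n ≤ frob (centeredDesign x n * (B - B₀)) ^ 2 := by
      rw [inv_mul_eq_div, le_div_iff₀ hn'] at hconv
      exact hconv
    have h2 : f * Z ≤ f * (√K * √(M : ℝ) * √(n : ℝ)) := by gcongr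
    have h3 : M * (lam * J B₀) ≤ M * (lam * C₀) := by gcongr
    linarith
  have hsM : √(M : ℝ) ^ 2 = M := Real.sq_sqrt hM'.le
  have hsn : √(n : ℝ) ^ 2 = n := Real.sq_sqrt hn'.le
  -- Division by `M * n` removes `M` altogether: the noise is of order `√(M n)` and `f = d √M`.
  have hred : c ^ 2 * d ^ 2 ≤ 2 * (d * (√K * √(1 / (n : ℝ)))) + (√C₀ * √(lam / n)) ^ 2 := by
    have hs1 : √(1 / (n : ℝ)) = √(n : ℝ) / n := by
      rw [one_div, Real.sqrt_inv, eq_div_iff hn'.ne', inv_mul_eq_div,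
        div_eq_iff (by positivity), ← sq, hsn]
    rw [mul_pow, Real.sq_sqrt hC₀, Real.sq_sqrt (by positivity), hs1]
    refine le_of_mul_le_mul_right ?_ (mul_pos hM' hn')
    have e1 : c ^ 2 * d ^ 2 * (M * n) = c ^ 2 * f ^ 2 * n := by
      rw [hd, mul_pow, hsM]
      ring
    have e2 : (2 * (d * (√K * (√(n : ℝ) / n))) + C₀ * (lam / n)) * (M * n)
        = 2 * (f * (√K * √(M : ℝ) * √(n : ℝ))) + M * (lam * C₀) := by
      have : f * √(M : ℝ) = d * M := by rw [hd, mul_assoc, ← sq, hsM]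
      have e3 : f * (√K * √(M : ℝ) * √(n : ℝ)) = (f * √(M : ℝ)) * (√K * √(n : ℝ)) := by ring
      rw [e3, this]
      field_simp
    rw [e1, e2]
    exact hmain
  have h := le_add_of_sq_le (by positivity) (by positivity) hc hred
  refine h.trans_eq ?_
  ring

/-- `R = O_P(a)` if, for every tolerance, `|R|` is bounded by a multiple of `a` outside of finitely
many exceptional events; here three of them. -/
theorem isBigOP_of_bound {Ω : Type*} [MeasurableSpace Ω] {P : Measure Ω} {R : ℕ → Ω → ℝ}
    {a : ℕ → ℝ} {A₁ A₂ : ℕ → Set Ω} {A₃ : ℝ → ℕ → Set Ω} {C : ℝ} (hC : 0 < C)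
    (h₁ : WithHighProb P A₁) (h₂ : WithHighProb P A₂)
    (h₃ : ∀ K > 0, ∀ᶠ n in atTop, P (A₃ K n) ≤ ENNReal.ofReal (C / K))
    (h : ∀ K > 0, ∃ K' > 0, ∀ᶠ n in atTop, ∀ ω ∈ A₁ n, ω ∈ A₂ n → ω ∉ A₃ K n →
      |R n ω| ≤ K' * a n) : IsBigOP P R a := by
  intro δ hδ
  have hδ3 : 0 < δ / 3 := by positivity
  have hpos : 0 < ENNReal.ofReal (δ / 3) := ENNReal.ofReal_pos.2 hδ3
  -- This level makes the tail bound `C / K` equal to `δ / 3`, one of three equal shares.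
  obtain ⟨K', hK', hbound⟩ := h (C / (δ / 3)) (by positivity)
  refine ⟨K', hK', ?_⟩
  filter_upwards [hbound, h₃ (C / (δ / 3)) (by positivity), h₁.eventually (gt_mem_nhds hpos),
    h₂.eventually (gt_mem_nhds hpos)] with n hn hn3 hn1 hn2
  have hsub : {ω | K' * a n < |R n ω|} ⊆ (A₁ n)ᶜ ∪ (A₂ n)ᶜ ∪ A₃ (C / (δ / 3)) n := by
    intro ω hω
    by_contra hcon
    simp only [Set.mem_union, Set.mem_compl_iff, not_or, not_not] at hcon
    exact absurd (hn ω hcon.1.1 hcon.1.2 hcon.2) (not_le.2 hω)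
  rw [div_div_cancel₀ hC.ne'] at hn3
  calc P {ω | K' * a n < |R n ω|} ≤ P ((A₁ n)ᶜ ∪ (A₂ n)ᶜ ∪ A₃ (C / (δ / 3)) n) := measure_mono hsub
    _ ≤ P (A₁ n)ᶜ + P (A₂ n)ᶜ + P (A₃ (C / (δ / 3)) n) :=
        (measure_union_le _ _).trans (add_le_add_left (measure_union_le _ _) _)
    _ ≤ ENNReal.ofReal (δ / 3) + ENNReal.ofReal (δ / 3) + ENNReal.ofReal (δ / 3) := by gcongr
    _ = ENNReal.ofReal δ := by
        rw [← ENNReal.ofReal_add hδ3.le hδ3.le, ← ENNReal.ofReal_add (by positivity) hδ3.le]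
        congr 1
        ring

end FrechetQuantile

open FrechetQuantile in
theorem theorem2 {Ω : Type*} [MeasurableSpace Ω] (P : Measure Ω) [IsProbabilityMeasure P]
    {p : ℕ} (S : Set ℝ) (𝓕 : Set (Measure ℝ))
    (X : Ω → EuclideanSpace ℝ (Fin p)) (Y : Ω → Measure ℝ)
    (F : EuclideanSpace ℝ (Fin p) → Measure ℝ)
    (α : ℝ → ℝ) (β : ℝ → EuclideanSpace ℝ (Fin p))
    -- the regression model and the assumptions on it
    (hmodel : IsFrechetModel P S 𝓕 X Y F α β)
    (hcenter : RegularCenter P S X F)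
    (hsubG : SubGaussianError P S X Y F)
    (hcov : HomogeneousCov P S X Y F)
    (hBV : BoundedVariationOn β (Set.Icc 0 1))
    -- the sample, the grid sizes, the tuning parameters and the penalty
    (Xs : ℕ → Ω → EuclideanSpace ℝ (Fin p)) (Ys : ℕ → Ω → Measure ℝ)
    (hsample : IsRandomSample P 𝓕 X Y Xs Ys)
    (r : ℕ) (M : ℕ → ℕ) (hr : ∀ n, r < min p (M n))
    (hrank : ∀ n, discretize β (M n) ∈ rankSet p (M n) r)
    (lam : ℕ → ℝ) (hlam : ∀ n, 0 < lam n)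
    (J : (m : ℕ) → Matrix (Fin p) (Fin m) ℝ → ℝ) (hJ : IsPenalty J)
    (hpen : PenaltyCondition β r M J)
    (hconv : RestrictedConvexity P Xs β r M)
    -- the estimator
    (Bhat : (n : ℕ) → Ω → Matrix (Fin p) (Fin (M n)) ℝ)
    (hBhat : WithHighProb P fun n =>
      {ω | IsSolution S (fun i => Xs i ω) (fun i => Ys i ω) n (M n) r (lam n) (J (M n))
        (Bhat n ω)}) :
    ∃ (R : ℕ → Ω → ℝ) (s : ℕ → ℝ),
      (∀ n ω, l2Dist (interpolate (Bhat n ω)) β ≤ R n ω + s n) ∧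
      IsBigOP P R (fun n => √((r : ℝ) * ((p : ℝ) + (M n : ℝ)) / (n : ℝ))
        + √(lam n * (p : ℝ) * (M n : ℝ) / (n : ℝ))) ∧
      s =O[atTop] fun n => (M n : ℝ) ^ (-(1 / 2) : ℝ) := by
  have hrp : ∀ n, r < p := fun n => lt_of_lt_of_le (hr n) (min_le_left _ _)
  have hM : ∀ n, 0 < M n := fun n =>
    (Nat.zero_le r).trans_lt (lt_of_lt_of_le (hr n) (min_le_right _ _))
  have hd0 : ∀ n ω, 0 ≤ scaledDist (Bhat n ω) (discretize β (M n)) := fun n ω =>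
    div_nonneg (frob_nonneg _) (Real.sqrt_nonneg _)
  refine ⟨fun n ω => 3 * scaledDist (Bhat n ω) (discretize β (M n)),
    fun n => 2 * (eVariationOn β (Set.Icc 0 1)).toReal * (M n : ℝ) ^ (-(1 / 2) : ℝ),
    fun n ω => l2Dist_interpolate_le hBV (hM n) (Bhat n ω), ?_,
    (isBigO_refl _ _).const_mul_left _⟩
  obtain ⟨C, hC, hnoise⟩ := hmodel.exists_design_noise_bound hsample
  -- A single threshold suffices, since the resulting bound extends to all matrices when `B* ≠ 0`.
  obtain ⟨c, hc, hRC⟩ := hconv 1 one_pos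
  refine isBigOP_of_bound hC hBhat hRC (A₃ := fun K n => {ω | K * (M n * n) <
    frob ((centeredDesign (fun i => Xs i ω) n).transpose * Matrix.of fun (i : Fin n) m =>
      gridError P S X α β (fun i => Xs i ω) (fun i => Ys i ω) (M n) i m) ^ 2}) ?_ ?_
  · intro K hK
    filter_upwards [eventually_gt_atTop 0] with n hn using hnoise n (M n) hn (hM n) K hK
  intro K hK
  rcases Nat.eq_zero_or_pos r with rfl | hr0
  · refine ⟨1, one_pos, Eventually.of_forall fun n ω hsol _ _ => ?_⟩
    have h1 : Bhat n ω = 0 := eq_zero_of_rank_eq_zero hsol.1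
    have h2 : discretize β (M n) = 0 := eq_zero_of_rank_eq_zero (hrank n)
    have h3 : scaledDist (Bhat n ω) (discretize β (M n)) = 0 := by
      simp [h1, h2, scaledDist, frob]
    rw [h3, mul_zero, abs_zero]
    positivity
  obtain ⟨K₀, hK₀, hK₀S⟩ := exists_abs_le_of_isCompact hmodel.isCompact
  obtain ⟨η, hη, hlow⟩ := exists_le_frob_discretize fun u hu j => hmodel.tendsto_coef_left hu j
  obtain ⟨C₀, hC₀, hJ₀⟩ := exists_penalty_le (mul_pos two_pos hK₀)
    (fun u hu j => hmodel.abs_coef_le hK₀S hu j) hη hlow hM hr0 hrank hJ hpen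
  refine ⟨3 * (2 * √K / c ^ 2 + √C₀ / c), by positivity, ?_⟩
  filter_upwards [eventually_gt_atTop 0] with n hn
  intro ω hsol hcv hno
  have hn' : (0 : ℝ) < n := by positivity
  have hB0 : discretize β (M n) ≠ 0 := by
    intro h0
    have h1 : (discretize β (M n)).rank = r := hrank n
    rw [h0, Matrix.rank_zero] at h1
    omega
  have hall := le_frob_mul_of_restricted (centeredDesign (fun i => Xs i ω) n) hB0
    (fun B hB hd => hcv B (hB.trans (hrank n)) hd) (Bhat n ω - discretize β (M n))
  have hbound := scaledDist_le_of_isSolution hsol (hrank n) hn (hM n) (hlam n).le (hJ.nonneg _ _)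
    hC₀.le (hJ₀ n)
    -- The intercept absorbs the centering at the population mean.
    (fun m => α (gridPoint (M n) m) - ∑ j, β (gridPoint (M n) m) j * meanVec P X j)
    (gridError P S X α β (fun i => Xs i ω) (fun i => Ys i ω) (M n))
    (fun i m => by
      simp only [gridError, discretize, Matrix.of_apply, mul_sub, Finset.sum_sub_distrib]
      ring) hc hK.le hall (not_lt.1 hno)
  have hM1 : (1 : ℝ) ≤ M n := by exact_mod_cast hM n
  have hp1 : (1 : ℝ) ≤ p := by exact_mod_cast (Nat.zero_le r).trans_lt (hrp n)
  have hr1 : (1 : ℝ) ≤ r := by exact_mod_cast hr0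
  -- Positive rank enters here, through `1 ≤ r * (p + M)`.
  have hs1 : √(1 / (n : ℝ)) ≤ √((r : ℝ) * ((p : ℝ) + (M n : ℝ)) / (n : ℝ)) := by
    gcongr
    nlinarith
  have hs2 : √(lam n / (n : ℝ)) ≤ √(lam n * (p : ℝ) * (M n : ℝ) / (n : ℝ)) := by
    gcongr
    rw [mul_assoc]
    exact le_mul_of_one_le_right (hlam n).le (by nlinarith)
  rw [abs_of_nonneg (mul_nonneg three_pos.le (hd0 n ω)), mul_assoc]
  refine mul_le_mul_of_nonneg_left (hbound.trans ?_) three_pos.le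
  set a := 2 * √K / c ^ 2
  set b := √C₀ / c
  have ha : 0 ≤ a := by positivity
  have hb : 0 ≤ b := by positivity
  set s₁ := √((r : ℝ) * ((p : ℝ) + (M n : ℝ)) / (n : ℝ))
  set s₂ := √(lam n * (p : ℝ) * (M n : ℝ) / (n : ℝ))
  have hs₁ : 0 ≤ s₁ := Real.sqrt_nonneg _
  have hs₂ : 0 ≤ s₂ := Real.sqrt_nonneg _
  calc a * √(1 / (n : ℝ)) + b * √(lam n / n) ≤ a * s₁ + b * s₂ := by gcongr
    _ ≤ (a + b) * (s₁ + s₂) := by nlinarith [mul_nonneg ha hs₂, mul_nonneg hb hs₁]
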